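/- Let $\sigma,d\ge 1$ be integers, $\mu\in\{1,-1\}$, $\mathbb T=\mathbb R/2\pi\mathbb Z$, and consider on $\mathbb T^d$ the nonlinear Schrödinger equation $$ i\partial_t\psi+\tfrac12\Delta\psi=\mu|\psi|^{2\sigma}\psi \tag{1}$$ and the renormalized cubic equation $$ i\partial_t\psi+\tfrac12\Delta\psi=\mu|\psi|^{2}\psi-\frac{2\mu}{(2\pi)^d}\Big(\int_{\mathbb T^d}|\psi(t,x)|^2\,dx\Big)\psi. \tag{2}$$ For $s\in\mathbb R$ and $p\in[1,\infty]$ let $\|f\|_{\mathcal FL^{s,p}(\mathbb T^d)}=\|\langle k\rangle^s\hat f(k)\|_{\ell^p_k(\mathbb Z^d)}$, where $\langle k\rangle=(1+|k|^2)^{1/2}$ and $\hat f(k)=(2\pi)^{-d}\int_{\mathbb T^d}f(x)e^{-ik\cdot x}\,dx$. (i) Assume $d\sigma\ge 2$ in the case of (1), and $d\ge 2$ in the case of (2). Then for every $s<0$ there exist a sequence of initial data $\varphi_n\in C^\infty(\mathbb T^d)$ with $$\|\varphi_n\|_{\mathcal FL^{s,p}(\mathbb T^d)}\to 0\quad\text{for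 all } p\in[1,\infty],$$ and a sequence of times $t_n>0$, $t_n\to0$, such that for every $n$ the equation (1), respectively (2), has a unique smooth solution $\psi_n$ on $[0,t_n]\times\mathbb T^d$ with $\psi_n(0)=\varphi_n$, and $$\|\psi_n(t_n)\|_{\mathcal FL^{r,p}(\mathbb T^d)}\to\infty\quad\text{for all } r\in\mathbb R \text{ and all } p\in[1,\infty].$$ (ii) If $d=\sigma=1$, then for every $s<-2/3$ the same conclusion holds for (1) and for (2). -/

import Mathlib

open scoped ENNReal ContDiff Laplacian
open MeasureTheory

noncomputable section

namespace PeriodicNLS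

/-- Functions on the torus `(ℝ/2πℤ)^d` are represented by functions on `ℝ^d`
that are `2π`-periodic in every coordinate. -/
def IsPeriodic {d : ℕ} (f : EuclideanSpace ℝ (Fin d) → ℂ) : Prop :=
  ∀ (i : Fin d) (x : EuclideanSpace ℝ (Fin d)),
    f (x + EuclideanSpace.single i (2 * Real.pi)) = f x

/-- The period cell `[0, 2π]^d`. -/
def cell (d : ℕ) : Set (EuclideanSpace ℝ (Fin d)) :=
  {x | ∀ i, x i ∈ Set.Icc 0 (2 * Real.pi)}

/-- `f̂(k) = (2π)^{-d} ∫_{𝕋^d} f(x) e^{-i k·x} dx`. -/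
def fourierCoeff {d : ℕ} (f : EuclideanSpace ℝ (Fin d) → ℂ) (k : Fin d → ℤ) : ℂ :=
  ((2 * Real.pi : ℝ) : ℂ)⁻¹ ^ d *
    ∫ x in cell d, f x * Complex.exp (-Complex.I * ((∑ i, (k i : ℝ) * x i : ℝ) : ℂ))

/-- `⟨k⟩ = (1 + |k|²)^{1/2}`. -/
def japaneseBracket {d : ℕ} (k : Fin d → ℤ) : ℝ :=
  Real.sqrt (1 + ∑ i, (k i : ℝ) ^ 2)

/-- The Fourier-Lebesgue norm `‖⟨·⟩^s f̂‖_{ℓ^p(ℤ^d)}`, with values in `[0, ∞]`. -/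
def flNorm {d : ℕ} (s : ℝ) (p : ℝ≥0∞) (f : EuclideanSpace ℝ (Fin d) → ℂ) : ℝ≥0∞ :=
  eLpNorm (fun k : Fin d → ℤ => ((japaneseBracket k ^ s : ℝ) : ℂ) * fourierCoeff f k) p
    Measure.count

/-- The nonlinearity `μ |ψ|^{2σ} ψ`. -/
def powerNonlinearity (d : ℕ) (μ : ℝ) (σ : ℕ) (f : EuclideanSpace ℝ (Fin d) → ℂ) :
    EuclideanSpace ℝ (Fin d) → ℂ :=
  fun x => (μ : ℂ) * ((‖f x‖ ^ (2 * σ) : ℝ) : ℂ) * f x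

/-- The nonlinearity `μ |ψ|² ψ - 2μ (2π)^{-d} (∫_{𝕋^d} |ψ|² dx) ψ`. -/
def renormalizedNonlinearity (d : ℕ) (μ : ℝ) (f : EuclideanSpace ℝ (Fin d) → ℂ) :
    EuclideanSpace ℝ (Fin d) → ℂ :=
  fun x => (μ : ℂ) * ((‖f x‖ ^ 2 : ℝ) : ℂ) * f x
    - ((2 * μ / (2 * Real.pi) ^ d * ∫ y in cell d, ‖f y‖ ^ 2 : ℝ) : ℂ) * f x

/-- `ψ` is a smooth solution on `[0, T] × 𝕋^d` of `i ∂ₜψ + ½ Δψ = F(ψ)`, the time derivatives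
being one-sided at the end points of `[0, T]`. -/
structure IsSmoothSolution {d : ℕ}
    (F : (EuclideanSpace ℝ (Fin d) → ℂ) → EuclideanSpace ℝ (Fin d) → ℂ) (T : ℝ)
    (ψ : ℝ → EuclideanSpace ℝ (Fin d) → ℂ) : Prop where
  periodic : ∀ t ∈ Set.Icc 0 T, IsPeriodic (ψ t)
  smooth : ContDiffOn ℝ ∞ (fun q : ℝ × EuclideanSpace ℝ (Fin d) => ψ q.1 q.2)
    (Set.Icc 0 T ×ˢ Set.univ)
  equation : ∀ t ∈ Set.Icc 0 T, ∀ x,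
    Complex.I * derivWithin (fun τ => ψ τ x) (Set.Icc 0 T) t + (1 / 2 : ℂ) * (Δ (ψ t)) x
      = F (ψ t) x

/-- Norm inflation at regularity `s` with infinite loss of regularity for
`i ∂ₜψ + ½ Δψ = F(ψ)` on `𝕋^d`: there are smooth data `φ n`, times `t n > 0` tending to `0`,
and the (unique) smooth solutions `ψ n` on `[0, t n]` with data `φ n`, such that `φ n → 0` in
`FL^{s,p}` for all `p ∈ [1, ∞]` while the `FL^{r,p}` norm of `ψ n (t n)` tends to `∞` for all
real `r` and all `p ∈ [1, ∞]`. -/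
def HasNormInflation {d : ℕ}
    (F : (EuclideanSpace ℝ (Fin d) → ℂ) → EuclideanSpace ℝ (Fin d) → ℂ) (s : ℝ) : Prop :=
  ∃ (φ : ℕ → EuclideanSpace ℝ (Fin d) → ℂ) (t : ℕ → ℝ)
    (ψ : ℕ → ℝ → EuclideanSpace ℝ (Fin d) → ℂ),
    (∀ n, ContDiff ℝ ∞ (φ n) ∧ IsPeriodic (φ n)) ∧
    (∀ p : ℝ≥0∞, 1 ≤ p → Filter.Tendsto (fun n => flNorm s p (φ n)) Filter.atTop (nhds 0)) ∧
    (∀ n, 0 < t n) ∧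
    Filter.Tendsto t Filter.atTop (nhds 0) ∧
    (∀ n, IsSmoothSolution F (t n) (ψ n) ∧ ψ n 0 = φ n) ∧
    (∀ n χ, IsSmoothSolution F (t n) χ → χ 0 = φ n →
      ∀ τ ∈ Set.Icc 0 (t n), χ τ = ψ n τ) ∧
    (∀ (r : ℝ) (p : ℝ≥0∞), 1 ≤ p →
      Filter.Tendsto (fun n => flNorm r p (ψ n (t n))) Filter.atTop (nhds ∞))

end PeriodicNLS

end

/-! Take as data A times a finite sum of plane waves with frequencies N κ_i, where the κ_i are fixed
and nonzero. In FL^{s,p} their size is at most a constant times A N^s, uniformly in p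
(`flNorm_packetData_le`). The quantity that blows up is the Fourier coefficient at frequency 0. Its
weight is ⟨0⟩^r = 1, so it bounds every FL^{r,p} norm from below (`le_flNorm`); this is the source
of the infinite loss of regularity.

In the interaction picture the equation is an ODE in an ℓ¹ algebra of Fourier coefficients weighted
by e^{ρ|k|}. The vector field is locally Lipschitz, so solutions exist for times of order A^{-2σ}.
With ρ = 1/N the data have norm O(A) uniformly in N, and ρ > 0 makes the solutions smooth. The zero
mode at time T is the first Picard iterate, of modulus A^{2σ+1} |∫₀ᵀ Σ e^{-iN²Et/2} dt|, up to an
error C A (T A^{2σ})² (`exists_solution_packet`). The sum runs over the interactions whose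
alternating frequency sum vanishes, and E is the alternating sum of the squared lengths. The
renormalization only adds a multiple of ψ, which does not affect this iterate because the data have
no zero mode.

If some interaction has E = 0, put T A^{2σ} = c with c small. As N → ∞ the nonresonant integrals
vanish and the main term is at least about cA, against an error Cc²A. One may take A large first and
N afterwards, so that A N^s is small for any s < 0 (`hasNormInflation_of_resonance`). For d ≥ 2 a
rectangle 0, a, a + b, b is resonant; for σ ≥ 2 one has 1 − 3 + 1 − 3 + 4 = 0 = 1 − 9 + 1 − 9 + 16.

For d = σ = 1 no interaction of nonzero frequencies that reaches 0 is resonant, and 1 − 2 + 1 = 0 is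
used on the time scale T = N^{-2} before it oscillates (`hasNormInflation_circle`). The main term is
then A³N^{-2}, the error is controlled when A is much smaller than N, and A = N^α with 2/3 < α <
min(1, −s) works exactly when s < −2/3.

Uniqueness among all smooth solutions is an L² energy estimate (`IsSmoothSolution.unique`). -/

open scoped NNReal

/-! ### The Banach space ℓ¹ and operators defined on its unit vectors -/

noncomputable section

namespace PeriodicNLS

/-- The space `ℓ¹(ι)` of absolutely summable complex families. -/
abbrev SummableFamily (ι : Type*) : Type _ := lp (fun _ : ι => ℂ) 1

namespace SummableFamily

variable {ι : Type*} {Y : Type*} [NormedAddCommGroup Y] [NormedSpace ℂ Y]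

theorem hasSum_norm (b : SummableFamily ι) : HasSum (fun k => ‖b k‖) ‖b‖ := by
  simpa using lp.hasSum_norm (p := 1) (by simp) b

theorem norm_apply_le (b : SummableFamily ι) (k : ι) : ‖b k‖ ≤ ‖b‖ :=
  lp.norm_apply_le_norm one_ne_zero b k

/-- The unit vectors of `ℓ¹(ι)`. -/
def delta [DecidableEq ι] (k : ι) : SummableFamily ι := lp.single 1 k 1

@[simp] theorem norm_delta [DecidableEq ι] (k : ι) : ‖delta k‖ = 1 := by
  simp [delta, lp.norm_single]

theorem delta_apply [DecidableEq ι] (k j : ι) : delta k j = if j = k then 1 else 0 := by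
  simp [delta, lp.single_apply, Pi.single_apply]

theorem hasSum_smul_delta [DecidableEq ι] (b : SummableFamily ι) :
    HasSum (fun k => b k • delta k) b := by
  have := lp.hasSum_single (p := 1) (by simp) b
  convert this using 2 with k
  rw [delta, ← lp.single_smul]; simp

/-- The unit vectors span a dense subspace. Most operator identities below are reduced by this to a
computation with exponentials. -/
theorem hom_ext [DecidableEq ι] {f g : SummableFamily ι →L[ℂ] Y}
    (h : ∀ k, f (delta k) = g (delta k)) : f = g := by
  ext b
  have hf := (hasSum_smul_delta b).mapL f
  have hg := (hasSum_smul_delta b).mapL g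
  refine hf.unique ?_
  convert hg using 2 with k
  simp [h]

theorem bilin_ext [DecidableEq ι] {f g : SummableFamily ι →L[ℂ] SummableFamily ι →L[ℂ] Y}
    (h : ∀ j k, f (delta j) (delta k) = g (delta j) (delta k)) : f = g :=
  hom_ext fun j => hom_ext fun k => h j k

/-- The `k`-th coordinate functional. -/
def coord (k : ι) : SummableFamily ι →L[ℂ] ℂ :=
  LinearMap.mkContinuous
    { toFun := fun b => b k
      map_add' := fun a b => by simp
      map_smul' := fun c a => by simp } 1 fun b => by 
    rw [one_mul]; exact norm_apply_le b k

@[simp] theorem coord_apply (k : ι) (b : SummableFamily ι) : coord k b = b k := rfl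

theorem norm_coord_le (k : ι) : ‖coord k‖ ≤ 1 :=
  LinearMap.mkContinuous_norm_le _ zero_le_one _

variable [CompleteSpace Y]

theorem summable_lift {B : ι → Y} (hB : ∀ k, ‖B k‖ ≤ 1) (b : SummableFamily ι) :
    Summable fun k => b k • B k := by
  refine Summable.of_norm_bounded (hasSum_norm b).summable fun k => ?_
  rw [norm_smul]
  exact mul_le_of_le_one_right (norm_nonneg _) (hB k)

/-- The bounded operator on `ℓ¹(ι)` that sends the `k`-th unit vector to `B k`. -/
def lift (B : ι → Y) (hB : ∀ k, ‖B k‖ ≤ 1) : SummableFamily ι →L[ℂ] Y :=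
  LinearMap.mkContinuous
    { toFun := fun b => ∑' k, b k • B k
      map_add' := fun a b => by
        rw [← (summable_lift hB a).tsum_add (summable_lift hB b)]
        simp [add_smul]
      map_smul' := fun c a => by
        simp only [RingHom.id_apply]
        rw [← (summable_lift hB a).tsum_const_smul c]
        simp [mul_smul] } 1 fun b => by
    have h : ∀ k, ‖b k • B k‖ ≤ ‖b k‖ := fun k => by
      rw [norm_smul]
      exact mul_le_of_le_one_right (norm_nonneg _) (hB k)
    rw [one_mul]
    exact tsum_of_norm_bounded (hasSum_norm b) h

theorem lift_apply {B : ι → Y} (hB : ∀ k, ‖B k‖ ≤ 1) (b : SummableFamily ι) :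
    lift B hB b = ∑' k, b k • B k := rfl

theorem norm_lift_le {B : ι → Y} (hB : ∀ k, ‖B k‖ ≤ 1) : ‖lift B hB‖ ≤ 1 :=
  LinearMap.mkContinuous_norm_le _ zero_le_one _

theorem norm_lift_apply_le {B : ι → Y} (hB : ∀ k, ‖B k‖ ≤ 1) (b : SummableFamily ι) :
    ‖lift B hB b‖ ≤ ‖b‖ := by
  simpa using (lift B hB).le_of_opNorm_le (norm_lift_le hB) b

@[simp] theorem lift_delta [DecidableEq ι] {B : ι → Y} (hB : ∀ k, ‖B k‖ ≤ 1) (k : ι) :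
    lift B hB (delta k) = B k := by
  rw [lift_apply, tsum_eq_single k]
  · simp [delta_apply]
  · intro j hj; simp [delta_apply, hj]


/-- Summable norms upgrade pointwise convergence of the series to convergence in operator norm,
which termwise differentiation requires. -/
theorem lift_eq_tsum {B : ι → Y} (hB : ∀ k, ‖B k‖ ≤ 1) (hs : Summable fun k => ‖B k‖) :
    lift B hB = ∑' k, (coord k).smulRight (B k) := by
  have hsum : Summable fun k => (coord k).smulRight (B k) := by
    refine Summable.of_norm_bounded hs fun k => ?_
    rw [ContinuousLinearMap.norm_smulRight_apply]
    exact mul_le_of_le_one_left (norm_nonneg _) (norm_coord_le k)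
  ext b
  have := hsum.hasSum.mapL (ContinuousLinearMap.apply ℂ Y b)
  rw [lift_apply]
  simpa using this.tsum_eq

end SummableFamily

/-! ### Smooth superpositions of plane waves -/

section PlaneWave

variable {E Z : Type*} [NormedAddCommGroup E] [NormedSpace ℝ E] [NormedAddCommGroup Z]
  [NormedSpace ℂ Z] [NormedSpace ℝ Z] [IsScalarTower ℝ ℂ Z]

theorem iteratedDeriv_cexp_smul (M : Z) (n : ℕ) :
    iteratedDeriv n (fun u : ℝ => Complex.exp (Complex.I * u) • M) =
      fun u : ℝ => (Complex.I ^ n * Complex.exp (Complex.I * u)) • M := by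
  induction n with
  | zero => simp
  | succ n ih =>
    rw [iteratedDeriv_succ, ih]
    funext u
    have h1 : HasDerivAt (fun u : ℝ => Complex.I * (u : ℂ)) Complex.I u := by
      simpa using (Complex.ofRealCLM.hasDerivAt (x := u)).const_mul Complex.I
    have h2 := ((h1.cexp).const_mul (Complex.I ^ n)).smul_const M
    rw [h2.deriv]
    congr 1
    ring

theorem contDiff_cexp_smul (ℓ : E →L[ℝ] ℝ) (M : Z) {n : WithTop ℕ∞} :
    ContDiff ℝ n fun x => Complex.exp (Complex.I * ℓ x) • M := by
  have h : ContDiff ℝ n fun x => ((ℓ x : ℝ) : ℂ) := Complex.ofRealCLM.contDiff.comp ℓ.contDiff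
  exact ((contDiff_const.mul h).cexp).smul contDiff_const

/-- Composition with a linear form reduces the bound to one real variable, where a derivative only
multiplies by i; each order costs one factor ‖ℓ‖. -/
theorem norm_iteratedFDeriv_cexp_smul_le (ℓ : E →L[ℝ] ℝ) (M : Z) (n : ℕ) (x : E) :
    ‖iteratedFDeriv ℝ n (fun x => Complex.exp (Complex.I * ℓ x) • M) x‖ ≤ ‖ℓ‖ ^ n * ‖M‖ := by
  have hg : ContDiff ℝ n fun u : ℝ => Complex.exp (Complex.I * u) • M := by
    simpa using contDiff_cexp_smul (ContinuousLinearMap.id ℝ ℝ) M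
  have h := ℓ.iteratedFDeriv_comp_right hg x le_rfl
  have h' : ((fun u : ℝ => Complex.exp (Complex.I * u) • M) ∘ ℓ) =
    fun x => Complex.exp (Complex.I * ℓ x) • M := rfl
  rw [h'] at h
  rw [h]
  refine (ContinuousMultilinearMap.norm_compContinuousLinearMap_le _ _).trans ?_
  rw [norm_iteratedFDeriv_eq_norm_iteratedDeriv, iteratedDeriv_cexp_smul, norm_smul]
  simp only [norm_mul, norm_pow, Complex.norm_I, one_pow, one_mul, Finset.prod_const,
    Finset.card_univ, Fintype.card_fin]
  rw [mul_comm Complex.I, Complex.norm_exp_ofReal_mul_I, one_mul, mul_comm]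

variable {ι : Type*} {Y : Type*} [NormedAddCommGroup Y] [NormedSpace ℂ Y]

theorem norm_weight_cexp_smul (w : ℝ) (θ : ℝ) (y : Y) (hw : 0 ≤ w) :
    ‖((w : ℂ) * Complex.exp (Complex.I * θ)) • y‖ = w * ‖y‖ := by
  rw [norm_smul, norm_mul, mul_comm Complex.I, Complex.norm_exp_ofReal_mul_I, mul_one,
    Complex.norm_real, Real.norm_of_nonneg hw]

/-- A superposition of plane waves with rapidly decreasing weights is a smooth family of
operators on `ℓ¹`. -/
theorem contDiff_lift {w : ι → ℝ} (hw : ∀ k, 0 ≤ w k) (ℓ : ι → E →L[ℝ] ℝ) {y : ι → Y}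
    [NormedSpace ℝ Y] [IsScalarTower ℝ ℂ Y] [CompleteSpace Y] (hy : ∀ k, ‖y k‖ ≤ 1)
    (hs : ∀ n : ℕ, Summable fun k => w k * ‖ℓ k‖ ^ n)
    (hB : ∀ x k, ‖((w k : ℂ) * Complex.exp (Complex.I * ℓ k x)) • y k‖ ≤ 1) :
    ContDiff ℝ ∞ fun x => SummableFamily.lift
      (fun k => ((w k : ℂ) * Complex.exp (Complex.I * ℓ k x)) • y k) (hB x) := by
  have hs0 : Summable w := by simpa using hs 0
  have key : ∀ x, SummableFamily.lift
      (fun k => ((w k : ℂ) * Complex.exp (Complex.I * ℓ k x)) • y k) (hB x) =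
      ∑' k, Complex.exp (Complex.I * ℓ k x) • (SummableFamily.coord k).smulRight
        ((w k : ℂ) • y k) := fun x => by
    rw [SummableFamily.lift_eq_tsum]
    · congr 1; funext k; ext b
      simp only [ContinuousLinearMap.smulRight_apply, _root_.smul_apply,
        SummableFamily.coord_apply, smul_smul]
      congr 1; ring
    · refine Summable.of_nonneg_of_le (fun _ => norm_nonneg _) (fun k => ?_) hs0
      rw [norm_weight_cexp_smul _ _ _ (hw k)]
      exact mul_le_of_le_one_right (hw k) (hy k)
  simp only [key]
  -- Termwise differentiation in operator norm, with majorant w_k ‖ℓ_k‖ⁿ for the derivatives of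
  -- order n.
  refine contDiff_tsum (v := fun n k => w k * ‖ℓ k‖ ^ n) (N := ⊤)
    (fun k => contDiff_cexp_smul _ _) (fun n _ => hs n) (fun n k x _ => ?_)
  refine (norm_iteratedFDeriv_cexp_smul_le _ _ _ _).trans ?_
  rw [mul_comm]
  refine mul_le_mul_of_nonneg_right ?_ (by positivity)
  rw [ContinuousLinearMap.norm_smulRight_apply, norm_smul, Complex.norm_real,
    Real.norm_of_nonneg (hw k)]
  calc _ ≤ 1 * (w k * 1) := by
        gcongr
        · exact mul_nonneg (hw k) (norm_nonneg _)
        · exact SummableFamily.norm_coord_le k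
        · exact hw k
        · exact hy k
    _ = w k := by ring

end PlaneWave

end PeriodicNLS
end

/-! ### Exponential weights on the frequency lattice and the free group -/

noncomputable section

namespace PeriodicNLS
variable {d : ℕ}

/-- The norm `|k|₁ = ∑ᵢ |kᵢ|` of a frequency. -/
def absSum (k : Fin d → ℤ) : ℝ := ∑ i, |(k i : ℝ)|

theorem absSum_nonneg (k : Fin d → ℤ) : 0 ≤ absSum k :=
  Finset.sum_nonneg fun _ _ => abs_nonneg _

@[simp] theorem absSum_zero : absSum (0 : Fin d → ℤ) = 0 := by simp [absSum]

theorem absSum_add_le (j k : Fin d → ℤ) : absSum (j + k) ≤ absSum j + absSum k := by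
  simp only [absSum, ← Finset.sum_add_distrib]
  exact Finset.sum_le_sum fun i _ => by push_cast [Pi.add_apply]; exact abs_add_le _ _

@[simp] theorem absSum_neg (k : Fin d → ℤ) : absSum (-k) = absSum k := by simp [absSum]

theorem abs_le_absSum (k : Fin d → ℤ) (i : Fin d) : |(k i : ℝ)| ≤ absSum k :=
  Finset.single_le_sum (f := fun i => |(k i : ℝ)|) (fun _ _ => abs_nonneg _) (Finset.mem_univ i)

theorem sum_sq_le_absSum_sq (k : Fin d → ℤ) : ∑ i, (k i : ℝ) ^ 2 ≤ absSum k ^ 2 := by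
  rw [sq (absSum k)]
  nth_rw 1 [absSum]
  rw [Finset.sum_mul]
  refine Finset.sum_le_sum fun i _ => ?_
  rw [← sq_abs, sq]
  exact mul_le_mul_of_nonneg_left (abs_le_absSum k i) (abs_nonneg _)

theorem summable_exp_neg_abs_int {θ : ℝ} (hθ : 0 < θ) :
    Summable fun n : ℤ => Real.exp (-θ * |(n : ℝ)|) := by
  have h : Summable fun n : ℕ => Real.exp (-θ * n) := by
    have := summable_geometric_of_lt_one (Real.exp_pos (-θ)).le (Real.exp_lt_one_iff.mpr (by linarith))
    refine this.congr fun n => ?_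
    rw [← Real.exp_nat_mul]; ring_nf
  refine Summable.of_nat_of_neg ?_ ?_ <;> simpa using h

/-- The weight is a product over the coordinates and a finite set of frequencies lies in a box, so
partial sums are bounded by a power of a geometric series. -/
theorem summable_exp_neg_absSum {θ : ℝ} (hθ : 0 < θ) :
    Summable fun k : Fin d → ℤ => Real.exp (-θ * absSum k) := by
  have h1 := summable_exp_neg_abs_int hθ
  refine summable_of_sum_le (c := (∑' n : ℤ, Real.exp (-θ * |(n : ℝ)|)) ^ d)
    (fun _ => (Real.exp_pos _).le) fun u => ?_
  set box := Fintype.piFinset fun i : Fin d => u.image fun k => k i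
  have hu : u ⊆ box := fun k hk =>
    Fintype.mem_piFinset.2 fun i => Finset.mem_image_of_mem _ hk
  calc ∑ k ∈ u, Real.exp (-θ * absSum k) ≤ ∑ k ∈ box, Real.exp (-θ * absSum k) :=
        Finset.sum_le_sum_of_subset_of_nonneg hu fun _ _ _ => (Real.exp_pos _).le
    _ = ∑ k ∈ box, ∏ i, Real.exp (-θ * |(k i : ℝ)|) := by
        refine Finset.sum_congr rfl fun k _ => ?_
        rw [← Real.exp_sum, absSum, Finset.mul_sum]
    _ = ∏ i : Fin d, ∑ n ∈ u.image (fun k => (k i : ℤ)), Real.exp (-θ * |((n : ℤ) : ℝ)|) :=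
        (Finset.prod_univ_sum (fun i : Fin d => u.image fun k => (k i : ℤ))
          fun _ n => Real.exp (-θ * |((n : ℤ) : ℝ)|)).symm
    _ ≤ ∏ i : Fin d, ∑' n : ℤ, Real.exp (-θ * |(n : ℝ)|) := by
        refine Finset.prod_le_prod (fun _ _ => Finset.sum_nonneg fun _ _ => (Real.exp_pos _).le)
          fun i _ => h1.sum_le_tsum _ fun _ _ => (Real.exp_pos _).le
    _ = _ := by simp

/-- Half of the exponential weight absorbs any power of a quadratically growing quantity. It is
applied to the norms of the phases, which grow like |k|². -/
theorem summable_exp_neg_absSum_mul_pow {θ : ℝ} (hθ : 0 < θ) {a : (Fin d → ℤ) → ℝ}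
    (ha : ∀ k, 0 ≤ a k) {C : ℝ} (hC : ∀ k, a k ≤ C * (1 + absSum k) ^ 2) (n : ℕ) :
    Summable fun k : Fin d → ℤ => Real.exp (-θ * absSum k) * a k ^ n := by
  have hC0 : 0 ≤ C := by simpa using (ha 0).trans (hC 0)
  obtain ⟨M, hM⟩ : ∃ M : ℝ, ∀ x : ℝ, 0 ≤ x → (C * (1 + x) ^ 2) ^ n ≤ M * Real.exp (θ / 2 * x) := by
    -- The constant comes from y^{2n}/(2n)! ≤ e^y at y = (θ/2)(1 + x).
    refine ⟨C ^ n * (Real.exp (θ / 2) * ((2 * n).factorial / (θ / 2) ^ (2 * n))), fun x hx => ?_⟩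
    have h := Real.pow_div_factorial_le_exp (x := θ / 2 * (1 + x)) (by positivity) (2 * n)
    rw [mul_pow (θ / 2), div_le_iff₀ (by positivity)] at h
    have h2 : Real.exp (θ / 2 * (1 + x)) = Real.exp (θ / 2) * Real.exp (θ / 2 * x) := by
      rw [← Real.exp_add]; ring_nf
    rw [mul_pow, ← pow_mul, mul_assoc (C ^ n)]
    refine mul_le_mul_of_nonneg_left ?_ (by positivity)
    rw [mul_div_assoc', div_mul_eq_mul_div, le_div_iff₀ (by positivity)]
    rw [h2] at h
    linarith
  refine Summable.of_nonneg_of_le (fun k => mul_nonneg (Real.exp_pos _).le (pow_nonneg (ha k) n))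
    (fun k => ?_) ((summable_exp_neg_absSum (d := d) (half_pos hθ)).mul_left M)
  calc Real.exp (-θ * absSum k) * a k ^ n
      ≤ Real.exp (-θ * absSum k) * (M * Real.exp (θ / 2 * absSum k)) := by
        gcongr
        exact (pow_le_pow_left₀ (ha k) (hC k) n).trans (hM _ (absSum_nonneg k))
    _ = M * Real.exp (-(θ / 2) * absSum k) := by
        rw [mul_left_comm, ← Real.exp_add]; ring_nf

/-- Functions on the frequency lattice, viewed as weighted Fourier coefficients. -/
abbrev Coeffs (d : ℕ) : Type := SummableFamily (Fin d → ℤ)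

open SummableFamily

theorem weight_le_one {ρ : ℝ} (hρ : 0 ≤ ρ) (k : Fin d → ℤ) : Real.exp (-ρ * absSum k) ≤ 1 :=
  Real.exp_le_one_iff.2 (by nlinarith [absSum_nonneg k])

/-- Multiplication of the coefficients by `e^{-θ|k|}`. -/
def damp (θ : ℝ≥0) : Coeffs d →L[ℂ] Coeffs d :=
  lift (fun k => (Real.exp (-(θ : ℝ) * absSum k) : ℂ) • delta k) fun k => by
    rw [norm_smul, norm_delta, mul_one, Complex.norm_real, Real.norm_of_nonneg (Real.exp_pos _).le]
    exact weight_le_one θ.2 k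

@[simp] theorem damp_delta (θ : ℝ≥0) (k : Fin d → ℤ) :
    damp θ (delta k) = (Real.exp (-(θ : ℝ) * absSum k) : ℂ) • delta k := lift_delta _ _

/-- The free phase `|k|²/2`. -/
def dispersion (k : Fin d → ℤ) : ℝ := (∑ i, (k i : ℝ) ^ 2) / 2

@[simp] theorem dispersion_zero : dispersion (0 : Fin d → ℤ) = 0 := by simp [dispersion]

theorem norm_cexp_I_mul (x : ℝ) : ‖Complex.exp (Complex.I * x)‖ = 1 := by
  rw [mul_comm, Complex.norm_exp_ofReal_mul_I]

/-- The free Schrödinger group, `b_k ↦ e^{-it|k|²/2} b_k`. -/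
def freeGroup (t : ℝ) : Coeffs d →L[ℂ] Coeffs d :=
  lift (fun k => Complex.exp (Complex.I * (-(dispersion k) * t : ℝ)) • delta k) fun k => by
    rw [norm_smul, norm_delta, mul_one, norm_cexp_I_mul]

@[simp] theorem freeGroup_delta (t : ℝ) (k : Fin d → ℤ) :
    freeGroup t (delta k) = Complex.exp (Complex.I * (-(dispersion k) * t : ℝ)) • delta k :=
  lift_delta _ _

theorem norm_freeGroup_apply_le (t : ℝ) (b : Coeffs d) : ‖freeGroup t b‖ ≤ ‖b‖ :=
  norm_lift_apply_le _ b

theorem freeGroup_neg_freeGroup (t : ℝ) (b : Coeffs d) : freeGroup t (freeGroup (-t) b) = b := by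
  have : (freeGroup t).comp (freeGroup (-t)) = ContinuousLinearMap.id ℂ (Coeffs d) := by
    refine hom_ext fun k => ?_
    simp [smul_smul, ← Complex.exp_add]
  exact DFunLike.congr_fun this b

theorem damp_freeGroup (θ : ℝ≥0) (t : ℝ) (b : Coeffs d) :
    damp θ (freeGroup t b) = freeGroup t (damp θ b) := by
  have : (damp θ).comp (freeGroup t) = (freeGroup t).comp (damp (d := d) θ) := by
    refine hom_ext fun k => ?_
    simp [smul_smul, mul_comm]
  exact DFunLike.congr_fun this b

theorem damp_damp (θ θ' : ℝ≥0) (b : Coeffs d) :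
    damp θ (damp θ' b) = damp (θ + θ') b := by
  have : (damp θ).comp (damp θ') = damp (d := d) (θ + θ') := by
    refine hom_ext fun k => ?_
    simp only [ContinuousLinearMap.comp_apply, damp_delta, map_smul, smul_smul]
    rw [← Complex.ofReal_mul, ← Real.exp_add]
    push_cast
    ring_nf
  exact DFunLike.congr_fun this b

theorem freeGroup_apply_coord (t : ℝ) (b : Coeffs d) (k : Fin d → ℤ) :
    freeGroup t b k = Complex.exp (Complex.I * (-(dispersion k) * t : ℝ)) * b k := by
  have : (coord k).comp (freeGroup t) =
      Complex.exp (Complex.I * (-(dispersion k) * t : ℝ)) • coord k := by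
    refine hom_ext fun j => ?_
    by_cases h : k = j <;> simp [delta_apply, h]
  exact DFunLike.congr_fun this b

theorem damp_apply_coord (θ : ℝ≥0) (b : Coeffs d) (k : Fin d → ℤ) :
    damp θ b k = Real.exp (-(θ : ℝ) * absSum k) * b k := by
  have : (coord k).comp (damp θ) = (Real.exp (-(θ : ℝ) * absSum k) : ℂ) • coord k := by
    refine hom_ext fun j => ?_
    by_cases h : k = j <;> simp [delta_apply, h]
  exact DFunLike.congr_fun this b

/-- Only strong continuity is claimed: the phases are unbounded in k, and smoothness in operator
norm needs the damping of `contDiff_damp_comp_freeGroup`. -/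
theorem continuous_freeGroup_apply (b : Coeffs d) : Continuous fun t => freeGroup t b := by
  simp only [freeGroup, lift_apply]
  refine continuous_tsum (fun k => ?_) (hasSum_norm b).summable fun k t => ?_
  · fun_prop
  · rw [norm_smul, norm_smul, norm_delta, mul_one, norm_cexp_I_mul, mul_one]

theorem continuous_freeGroup_uncurry :
    Continuous fun q : ℝ × Coeffs d => freeGroup q.1 q.2 := by
  refine continuous_prod_of_continuous_lipschitzWith' _ 1 (fun t => ?_) ?_
  · exact LipschitzWith.of_dist_le_mul fun a b => by
      rw [dist_eq_norm, dist_eq_norm, ← map_sub, NNReal.coe_one, one_mul]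
      exact norm_freeGroup_apply_le _ _
  · exact continuous_freeGroup_apply

/-- The damped free group is smooth in time, in operator norm. -/
theorem contDiff_damp_comp_freeGroup {θ : ℝ≥0} (hθ : 0 < θ) :
    ContDiff ℝ ∞ fun t : ℝ => (damp θ).comp (freeGroup (d := d) t) := by
  have hB : ∀ (t : ℝ) (k : Fin d → ℤ), ‖((Real.exp (-(θ : ℝ) * absSum k) : ℂ) * Complex.exp (Complex.I *
      ((-(dispersion k)) • ContinuousLinearMap.id ℝ ℝ) t)) • delta k‖ ≤ 1 := fun t k => by
    rw [norm_weight_cexp_smul _ _ _ (Real.exp_pos _).le, norm_delta, mul_one]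
    exact weight_le_one θ.2 k
  have h := contDiff_lift (w := fun k : Fin d → ℤ => Real.exp (-(θ : ℝ) * absSum k))
    (fun k => (Real.exp_pos _).le) (fun k => (-(dispersion k)) • ContinuousLinearMap.id ℝ ℝ)
    (y := delta) (fun k => (norm_delta k).le) (fun n => ?_) hB
  · convert h using 1
    funext t
    refine hom_ext fun k => ?_
    simp [smul_smul, mul_comm]
  · refine summable_exp_neg_absSum_mul_pow (NNReal.coe_pos.2 hθ) (fun k => norm_nonneg _) (C := 1) (fun k => ?_) n
    rw [norm_smul, Real.norm_eq_abs, abs_neg, ContinuousLinearMap.norm_id, mul_one,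
      abs_of_nonneg (div_nonneg (Finset.sum_nonneg fun _ _ => sq_nonneg _) zero_le_two), dispersion]
    nlinarith [sum_sq_le_absSum_sq k, absSum_nonneg k,
      Finset.sum_nonneg (fun i (_ : i ∈ Finset.univ) => sq_nonneg (k i : ℝ))]

end PeriodicNLS
end

/-! ### Integration over the period cell and Fourier coefficients -/

noncomputable section

namespace PeriodicNLS

variable {d : ℕ}

theorem cell_eq_preimage : cell d =
    (MeasurableEquiv.toLp 2 (Fin d → ℝ)).symm ⁻¹' Set.Icc 0 (fun _ => 2 * Real.pi) := by
  ext x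
  simp only [cell, Set.mem_ofPred_eq, Set.mem_preimage, Set.mem_Icc, Pi.le_def]
  exact ⟨fun h => ⟨fun i => (h i).1, fun i => (h i).2⟩, fun h i => ⟨h.1 i, h.2 i⟩⟩

theorem setIntegral_cell {Y : Type*} [NormedAddCommGroup Y] [NormedSpace ℝ Y]
    (f : EuclideanSpace ℝ (Fin d) → Y) :
    ∫ x in cell d, f x =
      ∫ y in Set.Icc (0 : Fin d → ℝ) (fun _ => 2 * Real.pi), f (WithLp.toLp 2 y) := by
  rw [cell_eq_preimage, ← (EuclideanSpace.volume_preserving_symm_measurableEquiv_toLp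
    (Fin d)).setIntegral_preimage_emb (MeasurableEquiv.measurableEmbedding _)]
  rfl

theorem volume_cell : volume (cell d) = ENNReal.ofReal ((2 * Real.pi) ^ d) := by
  rw [cell_eq_preimage, (EuclideanSpace.volume_preserving_symm_measurableEquiv_toLp
    (Fin d)).measure_preimage_equiv, Real.volume_Icc_pi]
  simp [ENNReal.ofReal_pow Real.two_pi_pos.le]

theorem isCompact_cell : IsCompact (cell d) := by
  have : cell d = WithLp.toLp 2 '' Set.Icc (0 : Fin d → ℝ) (fun _ => 2 * Real.pi) := by
    rw [cell_eq_preimage]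
    exact ((MeasurableEquiv.toLp 2 (Fin d → ℝ)).toEquiv.image_eq_preimage_symm _).symm
  rw [this]
  exact isCompact_Icc.image (PiLp.continuous_toLp 2 _)

theorem measurableSet_cell : MeasurableSet (cell d) := isCompact_cell.measurableSet

theorem integrableOn_cell {Y : Type*} [NormedAddCommGroup Y] {f : EuclideanSpace ℝ (Fin d) → Y}
    (hf : Continuous f) : IntegrableOn f (cell d) :=
  hf.continuousOn.integrableOn_compact isCompact_cell

/-- The integral over a period of a derivative of a periodic function vanishes. -/
theorem integral_cell_fderiv_eq_zero {g : EuclideanSpace ℝ (Fin d) → ℂ} (hg : ContDiff ℝ 1 g)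
    (hper : IsPeriodic g) (i : Fin d) :
    ∫ x in cell d, fderiv ℝ g x (EuclideanSpace.single i 1) = 0 := by
  -- The divergence theorem for boxes lives in dimension n + 1; the index i excludes d = 0.
  obtain ⟨n, rfl⟩ : ∃ n, d = n + 1 := ⟨d - 1, by have := i.2; omega⟩
  rw [setIntegral_cell]
  set T : (Fin (n + 1) → ℝ) →L[ℝ] EuclideanSpace ℝ (Fin (n + 1)) :=
    (PiLp.continuousLinearEquiv 2 ℝ (fun _ : Fin (n + 1) => ℝ)).symm.toContinuousLinearMap with hT
  have hTy : ∀ y, T y = WithLp.toLp 2 y := fun y => rfl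
  have hG : ContDiff ℝ 1 fun y => g (T y) := hg.comp T.contDiff
  have hdiff : ∀ y, HasFDerivAt (fun y => g (T y)) ((fderiv ℝ g (T y)).comp T) y := fun y =>
    ((hg.differentiable one_ne_zero _).hasFDerivAt).comp y T.hasFDerivAt
  have hTe : T (Pi.single i 1) = EuclideanSpace.single i 1 := rfl
  have hc : Continuous fun y => fderiv ℝ g (T y) (EuclideanSpace.single i 1) :=
    ((hg.continuous_fderiv one_ne_zero).comp T.continuous).clm_apply continuous_const
  have hsum : ∀ y, ∑ j, (if j = i then (fderiv ℝ g (T y)).comp T else 0) (Pi.single j 1) =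
      fderiv ℝ g (T y) (EuclideanSpace.single i 1) := fun y => by
    rw [Finset.sum_eq_single i (fun j _ hj => by simp [hj]) (by simp)]
    simp [hTe]
  -- Applied to the vector field whose only nonzero component is g, in direction i.
  have key := integral_divergence_of_hasFDerivAt_off_countable'
    (a := (0 : Fin (n + 1) → ℝ)) (b := fun _ => 2 * Real.pi) (fun _ => Real.two_pi_pos.le)
    (fun j y => if j = i then g (T y) else 0)
    (fun j y => if j = i then (fderiv ℝ g (T y)).comp T else 0) ∅ Set.countable_empty
    (fun j => by
      by_cases h : j = i
      · simpa [h] using hG.continuous.continuousOn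
      · simpa [h] using continuousOn_const)
    (fun y _ j => by
      by_cases h : j = i
      · simpa [h] using hdiff y
      · simpa [h] using hasFDerivAt_const (0 : ℂ) y)
    (by simp only [hsum]; exact hc.continuousOn.integrableOn_compact isCompact_Icc)
  simp only [hsum] at key
  simp only [← hTy]
  rw [key]
  refine Finset.sum_eq_zero fun j _ => ?_
  -- The two faces orthogonal to direction i differ by a period, so their contributions cancel; all
  -- other faces carry zero.
  by_cases h : j = i
  · subst h
    rw [sub_eq_zero]
    refine integral_congr_ae (Filter.Eventually.of_forall fun y => ?_)
    simp only [if_true]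
    refine Eq.trans ?_ (hper j _)
    congr 1
    ext l
    refine Fin.succAboveCases j ?_ (fun m => ?_) l
    · simp [hTy]
    · simp [hTy, Fin.succAbove_ne]
  · simp [h]

/-- The linear form `x ↦ k·x`. -/
def freqForm (k : Fin d → ℤ) : EuclideanSpace ℝ (Fin d) →L[ℝ] ℝ :=
  ∑ i, (k i : ℝ) • EuclideanSpace.proj i

theorem freqForm_apply (k : Fin d → ℤ) (x : EuclideanSpace ℝ (Fin d)) :
    freqForm k x = ∑ i, (k i : ℝ) * x i := by simp [freqForm]

theorem freqForm_add (j k : Fin d → ℤ) : freqForm (j + k) = freqForm j + freqForm k := by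
  simp [freqForm, add_smul, Finset.sum_add_distrib]

theorem freqForm_neg (k : Fin d → ℤ) : freqForm (-k) = -freqForm k := by
  simp [freqForm]

theorem freqForm_single (k : Fin d → ℤ) (i : Fin d) (c : ℝ) :
    freqForm k (EuclideanSpace.single i c) = k i * c := by
  simp [freqForm_apply]

theorem norm_freqForm_le (k : Fin d → ℤ) : ‖freqForm k‖ ≤ absSum k := by
  refine (norm_sum_le _ _).trans (Finset.sum_le_sum fun i _ => ?_)
  rw [norm_smul, Real.norm_eq_abs]
  refine mul_le_of_le_one_right (abs_nonneg _) ?_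
  refine ContinuousLinearMap.opNorm_le_bound _ zero_le_one fun x => ?_
  simpa using PiLp.norm_apply_le x i

theorem isPeriodic_cexp (k : Fin d → ℤ) :
    IsPeriodic fun x => Complex.exp (Complex.I * freqForm k x) := fun i x => by
  simp only [map_add, freqForm_single]
  rw [Complex.ofReal_add, mul_add, Complex.exp_add]
  have : Complex.exp (Complex.I * ((k i * (2 * Real.pi) : ℝ) : ℂ)) = 1 := by
    rw [Complex.exp_eq_one_iff]
    exact ⟨k i, by push_cast; ring⟩
  rw [this, mul_one]

theorem hasFDerivAt_cexp {E : Type*} [NormedAddCommGroup E] [NormedSpace ℝ E] (ℓ : E →L[ℝ] ℝ)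
    (x : E) : HasFDerivAt (fun x => Complex.exp (Complex.I * ℓ x))
      ((Complex.exp (Complex.I * ℓ x) * Complex.I) • (Complex.ofRealCLM.comp ℓ)) x := by
  have h := ((Complex.ofRealCLM.comp ℓ).hasFDerivAt (x := x)).const_mul Complex.I
  simpa [smul_smul] using h.cexp

/-- Orthogonality of the exponentials. -/
theorem integral_cell_cexp (k : Fin d → ℤ) :
    ∫ x in cell d, Complex.exp (Complex.I * freqForm k x) =
      if k = 0 then ((2 * Real.pi : ℝ) : ℂ) ^ d else 0 := by
  split_ifs with hk
  · subst hk
    simp [freqForm_apply, measureReal_def, volume_cell, ENNReal.toReal_ofReal,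
      pow_nonneg Real.two_pi_pos.le]
  · obtain ⟨i, hi⟩ : ∃ i, k i ≠ 0 := by
      by_contra! h
      exact hk (funext h)
    have hsm : ContDiff ℝ 1 fun x => Complex.exp (Complex.I * freqForm k x) := by
      simpa using contDiff_cexp_smul (freqForm k) (1 : ℂ)
    -- The i-th derivative multiplies the exponential by i k_i ≠ 0 and integrates to zero.
    have h := integral_cell_fderiv_eq_zero hsm (isPeriodic_cexp k) i
    simp only [(hasFDerivAt_cexp (freqForm k) _).fderiv] at h
    simp only [_root_.smul_apply, ContinuousLinearMap.comp_apply, freqForm_single,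
      mul_one, smul_eq_mul, Complex.ofRealCLM_apply, mul_assoc] at h
    rw [integral_mul_const] at h
    simpa [hi] using h

theorem fourierCoeff_cexp (j k : Fin d → ℤ) :
    fourierCoeff (fun x => Complex.exp (Complex.I * freqForm j x)) k = if k = j then 1 else 0 := by
  have h : ∀ x : EuclideanSpace ℝ (Fin d), Complex.exp (Complex.I * freqForm j x) *
      Complex.exp (-Complex.I * ((∑ i, (k i : ℝ) * x i : ℝ) : ℂ)) =
      Complex.exp (Complex.I * freqForm (j + -k) x) := fun x => by
    rw [← Complex.exp_add, freqForm_add, freqForm_neg, ← freqForm_apply]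
    simp; ring_nf
  have hpi : ((2 * Real.pi : ℝ) : ℂ) ≠ 0 := by exact_mod_cast Real.two_pi_pos.ne'
  simp only [fourierCoeff, h, integral_cell_cexp, add_neg_eq_zero]
  by_cases hjk : j = k
  · simp only [hjk, if_true]
    rw [← mul_pow, inv_mul_cancel₀ hpi, one_pow]
  · simp [hjk, Ne.symm hjk]

end PeriodicNLS
end

/-! ### Convolution, conjugation and synthesis on weighted coefficients -/

noncomputable section

namespace PeriodicNLS

open SummableFamily

variable {d : ℕ}

/-- Operators are complex linear while smoothness is over the reals, as conjugation demands;
restriction of scalars mediates. -/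
theorem contDiffOn_clm_apply {E V W : Type*} [NormedAddCommGroup E] [NormedSpace ℝ E]
    [NormedAddCommGroup V] [NormedSpace ℂ V] [NormedSpace ℝ V] [IsScalarTower ℝ ℂ V]
    [NormedAddCommGroup W] [NormedSpace ℂ W] [NormedSpace ℝ W] [IsScalarTower ℝ ℂ W]
    {n : WithTop ℕ∞} {s : Set E} {f : E → V →L[ℂ] W} {g : E → V} (hf : ContDiffOn ℝ n f s)
    (hg : ContDiffOn ℝ n g s) : ContDiffOn ℝ n (fun x => f x (g x)) s :=
  ((ContinuousLinearMap.restrictScalarsL ℂ V W ℝ ℝ).contDiff.comp_contDiffOn hf).clm_apply hg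

theorem contDiff_clm_apply {E V W : Type*} [NormedAddCommGroup E] [NormedSpace ℝ E]
    [NormedAddCommGroup V] [NormedSpace ℂ V] [NormedSpace ℝ V] [IsScalarTower ℝ ℂ V]
    [NormedAddCommGroup W] [NormedSpace ℂ W] [NormedSpace ℝ W] [IsScalarTower ℝ ℂ W]
    {n : WithTop ℕ∞} {f : E → V →L[ℂ] W} {g : E → V} (hf : ContDiff ℝ n f)
    (hg : ContDiff ℝ n g) : ContDiff ℝ n (fun x => f x (g x)) :=
  contDiffOn_univ.1 (contDiffOn_clm_apply hf.contDiffOn hg.contDiffOn)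

/-- The convolution of two families of Fourier coefficients, both weighted by `e^{ρ|k|}`. -/
def conv (ρ : ℝ≥0) : Coeffs d →L[ℂ] Coeffs d →L[ℂ] Coeffs d :=
  lift (fun j => lift (fun k =>
      (Real.exp (-(ρ : ℝ) * (absSum j + absSum k - absSum (j + k))) : ℂ) • delta (j + k))
    fun k => by
      rw [norm_smul, norm_delta, mul_one, Complex.norm_real,
        Real.norm_of_nonneg (Real.exp_pos _).le]
      exact Real.exp_le_one_iff.2 (by nlinarith [absSum_add_le j k, ρ.2])) fun j => norm_lift_le _

@[simp] theorem conv_delta_delta (ρ : ℝ≥0) (j k : Fin d → ℤ) :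
    conv ρ (delta j) (delta k) =
      (Real.exp (-(ρ : ℝ) * (absSum j + absSum k - absSum (j + k))) : ℂ) • delta (j + k) := by
  rw [conv, lift_delta, lift_delta]

theorem norm_conv_le (ρ : ℝ≥0) (b c : Coeffs d) : ‖conv ρ b c‖ ≤ ‖b‖ * ‖c‖ :=
  ((conv ρ b).le_opNorm c).trans
    (mul_le_mul_of_nonneg_right (norm_lift_apply_le _ b) (norm_nonneg _))

/-- Damping by e^{-θ|k|} converts weight θ + ρ into weight ρ for the same function, so it must
respect products. On unit vectors the terms θ|j + k| cancel. -/
theorem damp_conv (θ ρ : ℝ≥0) (b c : Coeffs d) :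
    damp θ (conv (θ + ρ) b c) = conv ρ (damp θ b) (damp θ c) := by
  have : (ContinuousLinearMap.compL ℂ (Coeffs d) (Coeffs d) (Coeffs d) (damp θ)).comp
      (conv (θ + ρ)) = (conv ρ).bilinearComp (damp θ) (damp (d := d) θ) := by
    refine bilin_ext fun j k => ?_
    simp only [ContinuousLinearMap.comp_apply, ContinuousLinearMap.compL_apply, conv_delta_delta,
      map_smul, damp_delta, ContinuousLinearMap.bilinearComp_apply, smul_smul,
      _root_.smul_apply]
    congr 1
    simp only [← Complex.ofReal_mul, ← Real.exp_add]
    congr 2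
    push_cast
    ring
  exact DFunLike.congr_fun (DFunLike.congr_fun this b) c

/-- The coefficients of the complex conjugate function, `k ↦ conj b_{-k}`. -/
def conjRefl (b : Coeffs d) : Coeffs d :=
  lift (fun k => delta (-k)) (fun _ => (norm_delta _).le) (star b)

/-- An antilinear substitute for `hom_ext`. -/
theorem apply_star_eq_conj {ι : Type*} [DecidableEq ι] {f g : SummableFamily ι →L[ℂ] ℂ}
    (h : ∀ k, f (delta k) = (starRingEnd ℂ) (g (delta k))) (b : SummableFamily ι) :
    f (star b) = (starRingEnd ℂ) (g b) := by
  have hf := (hasSum_smul_delta (star b)).mapL f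
  have hg := ((hasSum_smul_delta b).mapL g).map (starRingEnd ℂ) Complex.continuous_conj
  refine hf.unique ?_
  convert hg using 2 with k
  simp [h]

theorem conjRefl_apply (b : Coeffs d) (k : Fin d → ℤ) :
    conjRefl b k = (starRingEnd ℂ) (b (-k)) := by
  refine apply_star_eq_conj (f := (coord k).comp (lift (fun k => delta (-k))
    (fun _ => (norm_delta _).le))) (g := coord (-k)) (fun j => ?_) b
  by_cases h : k = -j
  · simp [delta_apply, h]
  · simp [delta_apply, h, neg_eq_iff_eq_neg]

theorem norm_conjRefl_le (b : Coeffs d) : ‖conjRefl b‖ ≤ ‖b‖ := by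
  have h := norm_lift_apply_le (fun k => (norm_delta (-k)).le) (star b)
  rwa [norm_star] at h

theorem conjRefl_sub (b c : Coeffs d) : conjRefl (b - c) = conjRefl b - conjRefl c := by
  ext k; simp [conjRefl_apply]

theorem conjRefl_add (b c : Coeffs d) : conjRefl (b + c) = conjRefl b + conjRefl c := by
  ext k; simp [conjRefl_apply]

theorem conjRefl_smul (z : ℂ) (b : Coeffs d) :
    conjRefl (z • b) = (starRingEnd ℂ) z • conjRefl b := by
  ext k; simp [conjRefl_apply]

theorem conjRefl_delta (k : Fin d → ℤ) : conjRefl (delta k) = delta (-k) := by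
  ext j
  by_cases h : j = -k
  · simp [conjRefl_apply, delta_apply, h]
  · simp [conjRefl_apply, delta_apply, h, neg_eq_iff_eq_neg]

theorem damp_conjRefl (θ : ℝ≥0) (b : Coeffs d) :
    damp θ (conjRefl b) = conjRefl (damp θ b) := by
  ext k
  simp [damp_apply_coord, conjRefl_apply, -Complex.ofReal_exp]

/-- `conjRefl` as a real linear map. -/
def conjReflL : Coeffs d →L[ℝ] Coeffs d :=
  LinearMap.mkContinuous
    { toFun := conjRefl
      map_add' := conjRefl_add
      map_smul' := fun r b => by
        ext k
        simp [conjRefl_apply] } 1 fun b => by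
    rw [one_mul]; exact norm_conjRefl_le b

theorem contDiff_conjRefl {n : WithTop ℕ∞} : ContDiff ℝ n (conjRefl (d := d)) :=
  (conjReflL (d := d)).contDiff

theorem contDiff_conv {n : WithTop ℕ∞} (ρ : ℝ≥0) {f g : Coeffs d → Coeffs d} (hf : ContDiff ℝ n f)
    (hg : ContDiff ℝ n g) : ContDiff ℝ n fun b => conv ρ (f b) (g b) := by
  have h : IsBoundedBilinearMap ℝ fun p : Coeffs d × Coeffs d => conv ρ p.1 p.2 :=
    { add_left := fun x y z => by simp
      smul_left := fun r x y => by
        simp only [RCLike.real_smul_eq_coe_smul (K := ℂ), map_smul, _root_.smul_apply]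
      add_right := fun x y z => by simp
      smul_right := fun r x y => by
        simp only [RCLike.real_smul_eq_coe_smul (K := ℂ), map_smul]
      bound := ⟨1, one_pos, fun x y => by simpa using norm_conv_le ρ x y⟩ }
  exact h.contDiff.comp (hf.prodMk hg)

/-- The phase `k·x - t|k|²/2` of a free plane wave. -/
def phase (k : Fin d → ℤ) : ℝ × EuclideanSpace ℝ (Fin d) →L[ℝ] ℝ :=
  (freqForm k).comp (ContinuousLinearMap.snd ℝ ℝ _) -
    dispersion k • ContinuousLinearMap.fst ℝ ℝ _

theorem phase_apply (k : Fin d → ℤ) (q : ℝ × EuclideanSpace ℝ (Fin d)) :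
    phase k q = freqForm k q.2 - dispersion k * q.1 := by simp [phase]

/-- The value at `(t, x)` of the free wave whose Fourier coefficients at time `0` are
`e^{-ρ|k|} b_k`. -/
def wave (ρ : ℝ≥0) (q : ℝ × EuclideanSpace ℝ (Fin d)) : Coeffs d →L[ℂ] ℂ :=
  lift (fun k => ((Real.exp (-(ρ : ℝ) * absSum k) : ℂ) *
      Complex.exp (Complex.I * phase k q)) • (1 : ℂ)) fun k => by
    rw [norm_weight_cexp_smul _ _ _ (Real.exp_pos _).le, norm_one, mul_one]
    exact weight_le_one ρ.2 k

theorem wave_delta (ρ : ℝ≥0) (q : ℝ × EuclideanSpace ℝ (Fin d)) (k : Fin d → ℤ) :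
    wave ρ q (delta k) = (Real.exp (-(ρ : ℝ) * absSum k) : ℂ) *
      Complex.exp (Complex.I * phase k q) := by
  rw [wave, lift_delta, smul_eq_mul, mul_one]

theorem dispersion_nonneg (k : Fin d → ℤ) : 0 ≤ dispersion k :=
  div_nonneg (Finset.sum_nonneg fun _ _ => sq_nonneg _) zero_le_two

theorem dispersion_le (k : Fin d → ℤ) : dispersion k ≤ absSum k ^ 2 := by
  have h := sum_sq_le_absSum_sq k
  have h0 := dispersion_nonneg k
  rw [dispersion] at *
  linarith

/-- The phase has norm at most |k| + |k|², so positive ρ pays for every derivative. -/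
theorem contDiff_wave {ρ : ℝ≥0} (hρ : 0 < ρ) : ContDiff ℝ ∞ (wave (d := d) ρ) := by
  refine contDiff_lift (fun k => (Real.exp_pos _).le) phase (fun _ => norm_one.le) (fun n => ?_) _
  refine summable_exp_neg_absSum_mul_pow (NNReal.coe_pos.2 hρ) (fun k => norm_nonneg _)
    (C := 1) (fun k => ?_) n
  have h1 : ‖phase k‖ ≤ absSum k + absSum k ^ 2 := by
    refine (norm_sub_le _ _).trans (add_le_add ?_ ?_)
    · refine (ContinuousLinearMap.opNorm_comp_le _ _).trans ?_
      exact (mul_le_of_le_one_right (norm_nonneg _) (ContinuousLinearMap.norm_snd_le ..)).trans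
        (norm_freqForm_le k)
    · rw [norm_smul, Real.norm_of_nonneg (dispersion_nonneg k)]
      exact (mul_le_of_le_one_right (dispersion_nonneg k)
        (ContinuousLinearMap.norm_fst_le ..)).trans (dispersion_le k)
  nlinarith [absSum_nonneg k]

theorem wave_damp (θ ρ : ℝ≥0) (q : ℝ × EuclideanSpace ℝ (Fin d)) (b : Coeffs d) :
    wave ρ q (damp θ b) = wave (θ + ρ) q b := by
  have : (wave ρ q).comp (damp θ) = wave (θ + ρ) q := by
    refine hom_ext fun k => ?_
    simp only [ContinuousLinearMap.comp_apply, damp_delta, map_smul, wave_delta, smul_eq_mul,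
      ← mul_assoc, ← Complex.ofReal_mul, ← Real.exp_add]
    push_cast
    ring_nf
  exact DFunLike.congr_fun this b

/-- The value at `x` of the function with Fourier coefficients `e^{-ρ|k|} b_k`. -/
def synth (ρ : ℝ≥0) (x : EuclideanSpace ℝ (Fin d)) : Coeffs d →L[ℂ] ℂ := wave ρ (0, x)

theorem synth_delta (ρ : ℝ≥0) (x : EuclideanSpace ℝ (Fin d)) (k : Fin d → ℤ) :
    synth ρ x (delta k) = (Real.exp (-(ρ : ℝ) * absSum k) : ℂ) *
      Complex.exp (Complex.I * freqForm k x) := by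
  rw [synth, wave_delta, phase_apply, mul_zero, sub_zero]

theorem synth_freeGroup (ρ : ℝ≥0) (t : ℝ) (x : EuclideanSpace ℝ (Fin d)) (b : Coeffs d) :
    synth ρ x (freeGroup t b) = wave ρ (t, x) b := by
  have : (synth ρ x).comp (freeGroup t) = wave ρ (t, x) := by
    refine hom_ext fun k => ?_
    simp only [ContinuousLinearMap.comp_apply, freeGroup_delta, map_smul, synth_delta, wave_delta,
      smul_eq_mul, phase_apply]
    rw [mul_left_comm, ← Complex.exp_add]
    congr 2
    push_cast
    ring
  exact DFunLike.congr_fun this b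

theorem synth_conv (ρ : ℝ≥0) (x : EuclideanSpace ℝ (Fin d)) (b c : Coeffs d) :
    synth ρ x (conv ρ b c) = synth ρ x b * synth ρ x c := by
  have : (ContinuousLinearMap.compL ℂ (Coeffs d) (Coeffs d) ℂ (synth ρ x)).comp (conv ρ) =
      (ContinuousLinearMap.mul ℂ ℂ).bilinearComp (synth ρ x) (synth ρ x) := by
    refine bilin_ext fun j k => ?_
    simp only [ContinuousLinearMap.comp_apply, ContinuousLinearMap.compL_apply, conv_delta_delta,
      map_smul, synth_delta, ContinuousLinearMap.bilinearComp_apply, smul_eq_mul,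
      ContinuousLinearMap.mul_apply', freqForm_add]
    rw [← mul_assoc, mul_mul_mul_comm, ← Complex.exp_add, ← Complex.ofReal_mul,
      ← Complex.ofReal_mul, ← Real.exp_add, ← Real.exp_add]
    congr 3
    · ring
    · simp; ring
  exact DFunLike.congr_fun (DFunLike.congr_fun this b) c

theorem synth_conjRefl (ρ : ℝ≥0) (x : EuclideanSpace ℝ (Fin d)) (b : Coeffs d) :
    synth ρ x (conjRefl b) = (starRingEnd ℂ) (synth ρ x b) := by
  refine apply_star_eq_conj (f := (synth ρ x).comp (lift (fun k => delta (-k))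
    (fun _ => (norm_delta _).le))) (g := synth ρ x) (fun j => ?_) b
  rw [ContinuousLinearMap.comp_apply, lift_delta, synth_delta, synth_delta, map_mul,
    Complex.conj_ofReal, ← Complex.exp_conj, map_mul, Complex.conj_I, Complex.conj_ofReal,
    absSum_neg, freqForm_neg]
  simp

theorem contDiff_synth {ρ : ℝ≥0} (hρ : 0 < ρ) : ContDiff ℝ ∞ (synth (d := d) ρ) :=
  (contDiff_wave hρ).comp (contDiff_const.prodMk contDiff_id)

theorem contDiff_synth_apply {ρ : ℝ≥0} (hρ : 0 < ρ) (b : Coeffs d) :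
    ContDiff ℝ ∞ fun x => synth ρ x b :=
  contDiff_clm_apply (contDiff_synth hρ) contDiff_const

theorem isPeriodic_synth (ρ : ℝ≥0) (b : Coeffs d) : IsPeriodic fun x => synth ρ x b := by
  intro i x
  have : synth ρ (x + EuclideanSpace.single i (2 * Real.pi)) = synth ρ x := by
    refine hom_ext fun k => ?_
    rw [synth_delta, synth_delta]
    congr 1
    exact isPeriodic_cexp k i x
  exact DFunLike.congr_fun this b

theorem fourierCoeff_synth {ρ : ℝ≥0} (hρ : 0 < ρ) (b : Coeffs d) (k : Fin d → ℤ) :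
    fourierCoeff (fun x => synth ρ x b) k = Real.exp (-(ρ : ℝ) * absSum k) * b k := by
  set e : EuclideanSpace ℝ (Fin d) → ℂ :=
    fun x => Complex.exp (-Complex.I * ((∑ i, (k i : ℝ) * x i : ℝ) : ℂ))
  -- Integrating the operator-valued function, rather than its value at b, leaves an identity of
  -- functionals to check on unit vectors.
  have hc : Continuous fun x => e x • synth (d := d) ρ x := by
    have he : Continuous e := by fun_prop
    exact he.smul (contDiff_synth hρ).continuous
  have hinteg := integrableOn_cell hc
  have happ : ∀ c : Coeffs d, fourierCoeff (fun x => synth ρ x c) k =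
      (((2 * Real.pi : ℝ) : ℂ)⁻¹ ^ d • ∫ x in cell d, e x • synth (d := d) ρ x) c := fun c => by
    rw [_root_.smul_apply, ContinuousLinearMap.integral_apply hinteg]
    simp [fourierCoeff, e, mul_comm]
  have : (((2 * Real.pi : ℝ) : ℂ)⁻¹ ^ d • ∫ x in cell d, e x • synth (d := d) ρ x) =
      (Real.exp (-(ρ : ℝ) * absSum k) : ℂ) • coord k := by
    refine hom_ext fun j => ?_
    rw [← happ]
    have h := fourierCoeff_cexp j k
    simp only [synth_delta, fourierCoeff, mul_assoc] at h ⊢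
    rw [integral_const_mul, mul_left_comm, h]
    by_cases hjk : k = j <;> simp [delta_apply, hjk]
  rw [happ, this]
  simp

end PeriodicNLS
end

/-! ### The nonlinearities on the Fourier side -/

noncomputable section

namespace PeriodicNLS

open SummableFamily

variable {d : ℕ}

/-- The Fourier coefficients of `|u|^{2 m} u`. -/
def powConv (ρ : ℝ≥0) : ℕ → Coeffs d → Coeffs d
  | 0, b => b
  | m + 1, b => conv ρ b (conv ρ (conjRefl b) (powConv ρ m b))

theorem contDiff_powConv (ρ : ℝ≥0) {n : WithTop ℕ∞} (m : ℕ) :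
    ContDiff ℝ n (powConv (d := d) ρ m) := by
  induction m with
  | zero => exact contDiff_id
  | succ m ih => exact contDiff_conv ρ contDiff_id (contDiff_conv ρ contDiff_conjRefl ih)

theorem damp_powConv (θ ρ : ℝ≥0) (m : ℕ) (b : Coeffs d) :
    damp θ (powConv (θ + ρ) m b) = powConv ρ m (damp θ b) := by
  induction m with
  | zero => rfl
  | succ m ih => simp only [powConv, damp_conv, damp_conjRefl, ih]

theorem synth_powConv (ρ : ℝ≥0) (m : ℕ) (b : Coeffs d) (x : EuclideanSpace ℝ (Fin d)) :
    synth ρ x (powConv ρ m b) = ((‖synth ρ x b‖ ^ (2 * m) : ℝ) : ℂ) * synth ρ x b := by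
  induction m with
  | zero => simp [powConv]
  | succ m ih =>
    rw [powConv, synth_conv, synth_conv, synth_conjRefl, ih, ← mul_assoc, Complex.mul_conj',
      ← mul_assoc]
    push_cast
    ring

theorem norm_powConv_le (ρ : ℝ≥0) (m : ℕ) (b : Coeffs d) {R : ℝ} (hb : ‖b‖ ≤ R) :
    ‖powConv ρ m b‖ ≤ R ^ (2 * m + 1) := by
  have hR : 0 ≤ R := (norm_nonneg b).trans hb
  induction m with
  | zero => simpa [powConv] using hb
  | succ m ih =>
    calc ‖powConv ρ (m + 1) b‖ ≤ ‖b‖ * (‖conjRefl b‖ * ‖powConv ρ m b‖) :=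
          (norm_conv_le _ _ _).trans
            (mul_le_mul_of_nonneg_left (norm_conv_le _ _ _) (norm_nonneg _))
      _ ≤ R * (R * R ^ (2 * m + 1)) := by
          gcongr
          exact (norm_conjRefl_le b).trans hb
      _ = R ^ (2 * (m + 1) + 1) := by ring

theorem norm_powConv_sub_le (ρ : ℝ≥0) (m : ℕ) {b c : Coeffs d} {R : ℝ} (hb : ‖b‖ ≤ R)
    (hc : ‖c‖ ≤ R) :
    ‖powConv ρ m b - powConv ρ m c‖ ≤ (2 * m + 1) * R ^ (2 * m) * ‖b - c‖ := by
  have hR : 0 ≤ R := (norm_nonneg b).trans hb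
  induction m with
  | zero => simp [powConv]
  | succ m ih =>
    -- Telescoping: one factor at a time is changed from b to c.
    have e : powConv ρ (m + 1) b - powConv ρ (m + 1) c =
        conv ρ (b - c) (conv ρ (conjRefl b) (powConv ρ m b)) +
        conv ρ c (conv ρ (conjRefl (b - c)) (powConv ρ m b)) +
        conv ρ c (conv ρ (conjRefl c) (powConv ρ m b - powConv ρ m c)) := by
      simp only [powConv, conjRefl_sub, map_sub, _root_.sub_apply]
      abel
    have hQ := norm_powConv_le ρ m b hb
    have n3 : ∀ x y z : Coeffs d, ‖conv ρ x (conv ρ y z)‖ ≤ ‖x‖ * (‖y‖ * ‖z‖) := fun x y z =>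
      (norm_conv_le _ _ _).trans (mul_le_mul_of_nonneg_left (norm_conv_le _ _ _) (norm_nonneg _))
    rw [e]
    refine (norm_add₃_le).trans ?_
    calc _ ≤ ‖b - c‖ * (R * R ^ (2 * m + 1)) + R * (‖b - c‖ * R ^ (2 * m + 1)) +
          R * (R * ((2 * m + 1) * R ^ (2 * m) * ‖b - c‖)) := by
          refine add_le_add (add_le_add ?_ ?_) ?_
          · refine (n3 _ _ _).trans ?_
            gcongr
            exact (norm_conjRefl_le b).trans hb
          · refine (n3 _ _ _).trans ?_
            gcongr
            exact norm_conjRefl_le _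
          · refine (n3 _ _ _).trans ?_
            gcongr
            exact (norm_conjRefl_le c).trans hc
      _ = _ := by push_cast; ring

/-- The action on (weighted) Fourier coefficients of a nonlinearity `F` on `𝕋^d` of degree
`2σ + 1` which is `μ |u|^{2σ} u` up to a multiple of `u`. -/
structure SpectralNonlinearity (d σ : ℕ) (μ : ℝ)
    (F : (EuclideanSpace ℝ (Fin d) → ℂ) → EuclideanSpace ℝ (Fin d) → ℂ) where
  toFun : ℝ≥0 → Coeffs d → Coeffs d
  const : ℝ
  const_pos : 0 < const
  contDiff : ∀ ρ, ContDiff ℝ ∞ (toFun ρ)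
  map_zero : ∀ ρ, toFun ρ 0 = 0
  norm_sub_le : ∀ ρ (b c : Coeffs d) (R : ℝ), ‖b‖ ≤ R → ‖c‖ ≤ R →
    ‖toFun ρ b - toFun ρ c‖ ≤ const * R ^ (2 * σ) * ‖b - c‖
  damp_apply : ∀ θ ρ b, damp θ (toFun (θ + ρ) b) = toFun ρ (damp θ b)
  synth_apply : ∀ ρ, 0 < ρ → ∀ b x, synth ρ x (toFun ρ b) = F (fun y => synth ρ y b) x
  zero_mode : ∀ ρ b, b 0 = 0 → toFun ρ b 0 = μ * powConv ρ σ b 0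

theorem powConv_zero (ρ : ℝ≥0) (m : ℕ) : powConv ρ m (0 : Coeffs d) = 0 := by
  cases m <;> simp [powConv]

/-- The power nonlinearity on Fourier coefficients. -/
def spectralPower (d σ : ℕ) {μ : ℝ} (hμ : |μ| ≤ 1) :
    SpectralNonlinearity d σ μ (powerNonlinearity d μ σ) where
  toFun ρ b := (μ : ℂ) • powConv ρ σ b
  const := 2 * σ + 1
  const_pos := by positivity
  contDiff ρ := contDiff_const.fun_smul (contDiff_powConv ρ σ)
  map_zero ρ := by rw [powConv_zero, smul_zero]
  norm_sub_le ρ b c R hb hc := by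
    rw [← smul_sub, norm_smul, Complex.norm_real]
    exact (mul_le_of_le_one_left (norm_nonneg _) hμ).trans (norm_powConv_sub_le ρ σ hb hc)
  damp_apply θ ρ b := by rw [map_smul, damp_powConv]
  synth_apply ρ _ b x := by
    rw [map_smul, synth_powConv, powerNonlinearity, smul_eq_mul, mul_assoc]
  zero_mode ρ b _ := by simp [-Complex.coe_smul]

/-- The mass `∑ |û_k|²`, as the zero mode of `|u|²`. -/
def mass (ρ : ℝ≥0) (b : Coeffs d) : ℂ := coord 0 (conv ρ b (conjRefl b))

theorem mass_damp (θ ρ : ℝ≥0) (b : Coeffs d) : mass ρ (damp θ b) = mass (θ + ρ) b := by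
  rw [mass, mass, ← damp_conjRefl, ← damp_conv, coord_apply, coord_apply, damp_apply_coord]
  simp

theorem contDiff_mass (ρ : ℝ≥0) {n : WithTop ℕ∞} : ContDiff ℝ n (mass (d := d) ρ) :=
  contDiff_clm_apply contDiff_const (contDiff_conv ρ contDiff_id contDiff_conjRefl)

theorem norm_mass_le (ρ : ℝ≥0) (b : Coeffs d) : ‖mass ρ b‖ ≤ ‖b‖ ^ 2 := by
  rw [sq]
  exact (norm_apply_le _ _).trans ((norm_conv_le _ _ _).trans
    (mul_le_mul_of_nonneg_left (norm_conjRefl_le b) (norm_nonneg _)))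

theorem norm_mass_sub_le (ρ : ℝ≥0) {b c : Coeffs d} {R : ℝ} (hb : ‖b‖ ≤ R) (hc : ‖c‖ ≤ R) :
    ‖mass ρ b - mass ρ c‖ ≤ 2 * R * ‖b - c‖ := by
  have e : mass ρ b - mass ρ c = coord 0 (conv ρ (b - c) (conjRefl b)) +
      coord 0 (conv ρ c (conjRefl (b - c))) := by
    simp only [mass, conjRefl_sub, map_sub, _root_.sub_apply]
    abel
  rw [e]
  refine (norm_add_le _ _).trans ?_
  have h1 := (norm_apply_le (conv ρ (b - c) (conjRefl b)) 0).trans (norm_conv_le _ _ _)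
  have h2 := (norm_apply_le (conv ρ c (conjRefl (b - c))) 0).trans (norm_conv_le _ _ _)
  have h3 := mul_le_mul_of_nonneg_left ((norm_conjRefl_le b).trans hb) (norm_nonneg (b - c))
  have h4 := mul_le_mul hc (norm_conjRefl_le (b - c)) (norm_nonneg _) ((norm_nonneg c).trans hc)
  simp only [coord_apply]
  linarith

/-- Parseval, read off from the zeroth Fourier coefficient of the product of u and its conjugate. -/
theorem integral_cell_norm_sq_synth {ρ : ℝ≥0} (hρ : 0 < ρ) (b : Coeffs d) :
    (((∫ y in cell d, ‖synth ρ y b‖ ^ 2 : ℝ)) : ℂ) = ((2 * Real.pi : ℝ) : ℂ) ^ d * mass ρ b := by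
  have h := fourierCoeff_synth hρ (conv ρ b (conjRefl b)) 0
  have hpi : ((2 * Real.pi : ℝ) : ℂ) ≠ 0 := by exact_mod_cast Real.two_pi_pos.ne'
  simp only [fourierCoeff, synth_conv, synth_conjRefl, Complex.mul_conj', absSum_zero, mul_zero,
    Real.exp_zero, Complex.ofReal_one, one_mul, Pi.zero_apply, Int.cast_zero, zero_mul,
    Finset.sum_const_zero, Complex.ofReal_zero, Complex.exp_zero, mul_one] at h
  rw [mass, coord_apply, ← h, ← mul_assoc, ← mul_pow, mul_inv_cancel₀ hpi, one_pow, one_mul,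
    ← integral_complex_ofReal]
  push_cast
  rfl

/-- The renormalized cubic nonlinearity on Fourier coefficients. -/
def spectralRenormalized (d : ℕ) {μ : ℝ} (hμ : |μ| ≤ 1) :
    SpectralNonlinearity d 1 μ (renormalizedNonlinearity d μ) where
  toFun ρ b := (μ : ℂ) • (powConv ρ 1 b - (2 * mass ρ b) • b)
  -- 9 = 3 + 4 + 2: the cubic term, the difference of the masses, and the mass times the difference.
  const := 9
  const_pos := by norm_num
  contDiff ρ := contDiff_const.fun_smul ((contDiff_powConv ρ 1).sub
    ((contDiff_const.mul (contDiff_mass ρ)).fun_smul contDiff_id))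
  map_zero ρ := by rw [powConv_zero, smul_zero, sub_zero, smul_zero]
  norm_sub_le ρ b c R hb hc := by
    have hR : 0 ≤ R := (norm_nonneg b).trans hb
    rw [← smul_sub, norm_smul, Complex.norm_real]
    refine (mul_le_of_le_one_left (norm_nonneg _) hμ).trans ?_
    have e : powConv ρ 1 b - (2 * mass ρ b) • b - (powConv ρ 1 c - (2 * mass ρ c) • c) =
        (powConv ρ 1 b - powConv ρ 1 c) - ((2 * (mass ρ b - mass ρ c)) • b +
          (2 * mass ρ c) • (b - c)) := by
      simp only [mul_sub, sub_smul, smul_sub]; abel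
    rw [e]
    refine (norm_sub_le _ _).trans ?_
    have h1 := norm_powConv_sub_le ρ 1 hb hc
    have h2 : ‖(2 * (mass ρ b - mass ρ c)) • b‖ ≤ 2 * (2 * R * ‖b - c‖) * R := by
      rw [norm_smul, norm_mul, Complex.norm_ofNat]
      gcongr
      exact norm_mass_sub_le ρ hb hc
    have h3 : ‖(2 * mass ρ c) • (b - c)‖ ≤ 2 * R ^ 2 * ‖b - c‖ := by
      rw [norm_smul, norm_mul, Complex.norm_ofNat]
      gcongr
      exact (norm_mass_le ρ c).trans (by gcongr)
    have h4 := norm_add_le ((2 * (mass ρ b - mass ρ c)) • b) ((2 * mass ρ c) • (b - c))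
    norm_num at h1 ⊢
    nlinarith
  damp_apply θ ρ b := by
    simp only [map_smul, map_sub, damp_powConv, mass_damp]
  synth_apply ρ hρ b x := by
    have hpi : ((2 * Real.pi : ℝ) : ℂ) ^ d ≠ 0 :=
      pow_ne_zero _ (by exact_mod_cast Real.two_pi_pos.ne')
    rw [map_smul, map_sub, map_smul, synth_powConv, renormalizedNonlinearity, Complex.ofReal_mul,
      integral_cell_norm_sq_synth hρ, Complex.ofReal_div, Complex.ofReal_pow (2 * Real.pi), smul_eq_mul,
      smul_eq_mul, ← mul_assoc (_ / _), div_mul_cancel₀ _ hpi]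
    push_cast
    ring
  -- The renormalizing term is a multiple of b, invisible at frequency 0 because b vanishes there.
  zero_mode ρ b hb := by
    change coord 0 ((μ : ℂ) • (powConv ρ 1 b - (2 * mass ρ b) • b)) = _
    rw [map_smul, map_sub, map_smul, coord_apply, coord_apply, hb, smul_zero, sub_zero,
      smul_eq_mul]

end PeriodicNLS
end

/-! ### The interaction picture: local existence and smoothness -/

noncomputable section

namespace PeriodicNLS

open SummableFamily

variable {d σ : ℕ} {μ : ℝ}
  {F : (EuclideanSpace ℝ (Fin d) → ℂ) → EuclideanSpace ℝ (Fin d) → ℂ}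

namespace SpectralNonlinearity

/-- The vector field of the equation in the interaction picture. -/
def field (S : SpectralNonlinearity d σ μ F) (ρ : ℝ≥0) (t : ℝ) (b : Coeffs d) : Coeffs d :=
  (-Complex.I) • freeGroup (-t) (S.toFun ρ (freeGroup t b))

variable (S : SpectralNonlinearity d σ μ F) (ρ : ℝ≥0)

theorem norm_field_sub_le (t : ℝ) {b c : Coeffs d} {R : ℝ} (hb : ‖b‖ ≤ R) (hc : ‖c‖ ≤ R) :
    ‖S.field ρ t b - S.field ρ t c‖ ≤ S.const * R ^ (2 * σ) * ‖b - c‖ := by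
  rw [field, field, ← smul_sub, ← map_sub, norm_smul, norm_neg, Complex.norm_I, one_mul]
  refine (norm_freeGroup_apply_le _ _).trans ?_
  refine (S.norm_sub_le ρ _ _ R ((norm_freeGroup_apply_le _ _).trans hb)
    ((norm_freeGroup_apply_le _ _).trans hc)).trans ?_
  rw [← map_sub]
  have hR : 0 ≤ R := (norm_nonneg b).trans hb
  exact mul_le_mul_of_nonneg_left (norm_freeGroup_apply_le _ _)
    (mul_nonneg S.const_pos.le (pow_nonneg hR _))

theorem field_zero (t : ℝ) : S.field ρ t 0 = 0 := by simp [field, S.map_zero]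

theorem norm_field_le (t : ℝ) {b : Coeffs d} {R : ℝ} (hb : ‖b‖ ≤ R) :
    ‖S.field ρ t b‖ ≤ S.const * R ^ (2 * σ) * R := by
  have hR : 0 ≤ R := (norm_nonneg b).trans hb
  have h := S.norm_field_sub_le ρ t hb (c := 0) (by simpa using hR)
  rw [field_zero, sub_zero, sub_zero] at h
  exact h.trans (mul_le_mul_of_nonneg_left hb (mul_nonneg S.const_pos.le (pow_nonneg hR _)))

theorem continuous_field (b : Coeffs d) : Continuous fun t => S.field ρ t b := by
  have h1 : Continuous fun t => S.toFun ρ (freeGroup t b) :=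
    (S.contDiff ρ).continuous.comp (continuous_freeGroup_apply b)
  have h2 : Continuous fun t => ((-t, S.toFun ρ (freeGroup t b)) : ℝ × Coeffs d) :=
    continuous_neg.prodMk h1
  have h3 := (continuous_freeGroup_uncurry (d := d)).comp h2
  exact (continuous_const_smul (-Complex.I)).comp h3

/-- Picard–Lindelöf on the ball of radius R about φ. There the field is at most 2RK with K =
const·(2R)^{2σ}, so the solution cannot leave while 2KT ≤ 1. -/
theorem exists_profile {φ : Coeffs d} {R T : ℝ} (hφ : ‖φ‖ ≤ R) (hT : 0 ≤ T)
    (hsmall : S.const * (2 * R) ^ (2 * σ) * T * 2 ≤ 1) :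
    ∃ v : ℝ → Coeffs d, v 0 = φ ∧ (∀ t ∈ Set.Icc 0 T, ‖v t‖ ≤ 2 * R) ∧
      ∀ t ∈ Set.Icc 0 T, HasDerivWithinAt v (S.field ρ t (v t)) (Set.Icc 0 T) t := by
  have hR : 0 ≤ R := (norm_nonneg φ).trans hφ
  have hK : 0 ≤ S.const * (2 * R) ^ (2 * σ) := mul_nonneg S.const_pos.le (by positivity)
  have hball : ∀ b ∈ Metric.closedBall φ R, ‖b‖ ≤ 2 * R := fun b hb => by
    have h1 : ‖b - φ‖ ≤ R := by simpa [dist_eq_norm] using hb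
    have h2 := norm_add_le (b - φ) φ
    rw [sub_add_cancel] at h2
    linarith
  have hT0 : (0 : ℝ) ∈ Set.Icc 0 T := Set.left_mem_Icc.2 hT
  have hPL : IsPicardLindelof (S.field ρ) (tmin := 0) (tmax := T) ⟨0, hT0⟩ φ ⟨R, hR⟩ 0
      ⟨S.const * (2 * R) ^ (2 * σ) * (2 * R), by positivity⟩
      ⟨S.const * (2 * R) ^ (2 * σ), hK⟩ :=
    { lipschitzOnWith := fun t _ => LipschitzOnWith.of_dist_le_mul fun b hb c hc => by
        rw [dist_eq_norm, dist_eq_norm]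
        exact S.norm_field_sub_le ρ t (hball b hb) (hball c hc)
      continuousOn := fun b _ => (S.continuous_field ρ b).continuousOn
      norm_le := fun t _ b hb => S.norm_field_le ρ t (hball b hb)
      mul_max_le := by
        change S.const * (2 * R) ^ (2 * σ) * (2 * R) * max (T - 0) (0 - 0) ≤ R - 0
        rw [sub_zero, sub_zero, sub_zero, max_eq_left hT]
        nlinarith }
  have hx : φ ∈ Metric.closedBall φ ((0 : ℝ≥0) : ℝ) := Metric.mem_closedBall_self le_rfl
  -- The fixed point itself is used because it also carries the ball membership that yields the
  -- bound 2R.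
  obtain ⟨α, hα⟩ := ODE.FunSpace.exists_isFixedPt_next hPL hx
  refine ⟨α.compProj, ?_, fun t _ => hball _ (α.compProj_mem_closedBall hPL.mul_max_le),
    fun t ht => ?_⟩
  · have := ODE.FunSpace.next_apply₀ hPL hx α
    rw [hα] at this
    have h0 : α.compProj ((⟨0, hT0⟩ : Set.Icc 0 T) : ℝ) = _ := ODE.FunSpace.compProj_val
    exact h0.trans this
  · refine (ODE.hasDerivWithinAt_picard_Icc (t₀ := 0) hT0 hPL.continuousOn_uncurry
      α.continuous_compProj.continuousOn (fun _ _ => α.compProj_mem_closedBall hPL.mul_max_le)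
      φ ht).congr_of_mem (fun s hs => ?_) ht
    have := ODE.FunSpace.next_apply hPL hx α (t := ⟨s, hs⟩)
    rw [hα] at this
    exact (ODE.FunSpace.compProj_of_mem hs).trans this

variable {ρ} {T : ℝ} {v : ℝ → Coeffs d}

/-- The profile is smooth in time, at the cost of an arbitrarily small loss of analyticity. -/
theorem contDiffOn_damp_profile (hT : 0 < T)
    (hv : ∀ t ∈ Set.Icc 0 T, HasDerivWithinAt v (S.field ρ t (v t)) (Set.Icc 0 T) t) (n : ℕ) :
    ∀ θ ρ' : ℝ≥0, 0 < θ → ρ = θ + ρ' →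
      ContDiffOn ℝ n (fun t => damp θ (v t)) (Set.Icc 0 T) := by
  have hder : ∀ θ : ℝ≥0, ∀ t ∈ Set.Icc 0 T,
      HasDerivWithinAt (fun t => damp θ (v t)) (damp θ (S.field ρ t (v t))) (Set.Icc 0 T) t :=
    fun θ t ht => ((damp θ).restrictScalars ℝ).hasFDerivAt.comp_hasDerivWithinAt t (hv t ht)
  induction n with
  | zero =>
    intro θ ρ' _ _
    exact contDiffOn_zero.2 fun t ht => (hder θ t ht).continuousWithinAt
  | succ n ih =>
    intro θ ρ' hθ hρ
    have hU := uniqueDiffOn_Icc hT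
    rw [Nat.cast_succ, contDiffOn_succ_iff_derivWithin hU]
    refine ⟨fun t ht => (hder θ t ht).differentiableWithinAt, by simp, ?_⟩
    -- The damping is spent in four equal parts: one for the induction hypothesis, one to make the
    -- inner free group smooth in time, two for the outer free group.
    obtain ⟨η, hη, rfl⟩ : ∃ η : ℝ≥0, 0 < η ∧ θ = (η + η) + (η + η) :=
      ⟨θ / 4, by positivity, by rw [← NNReal.coe_inj]; push_cast; ring⟩
    have key : ∀ t ∈ Set.Icc 0 T, derivWithin (fun t => damp (η + η + (η + η)) (v t))
        (Set.Icc 0 T) t = (-Complex.I) • ((damp (η + η)).comp (freeGroup (-t)))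
          (S.toFun (η + η + ρ') (((damp η).comp (freeGroup t)) (damp η (v t)))) := by
      intro t ht
      rw [(hder _ t ht).derivWithin (hU t ht), field, map_smul]
      congr 1
      rw [← damp_damp (η + η) (η + η), ContinuousLinearMap.comp_apply,
        ContinuousLinearMap.comp_apply, ← damp_freeGroup η, damp_damp η η,
        damp_freeGroup (η + η) (-t), hρ, add_assoc (η + η), S.damp_apply]
    refine ContDiffOn.congr ?_ key
    have h1 := ih η (η + (η + η) + ρ') hη (by rw [hρ]; ring)
    have h2 := contDiffOn_clm_apply
      ((contDiff_damp_comp_freeGroup (d := d) hη).of_le (by exact_mod_cast le_top)).contDiffOn h1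
    have h3 := ((S.contDiff (η + η + ρ')).of_le (m := n)
      (by exact_mod_cast le_top)).comp_contDiffOn h2
    have h4 : ContDiff ℝ n fun t : ℝ => (damp (η + η)).comp (freeGroup (d := d) (-t)) :=
      ((contDiff_damp_comp_freeGroup (d := d) (θ := η + η) (by positivity)).of_le
        (by exact_mod_cast le_top)).comp contDiff_neg
    exact contDiffOn_const.fun_smul (contDiffOn_clm_apply h4.contDiffOn h3)

/-- Half of the weight makes the profile smooth in time, the other half makes the wave operator
smooth in (t, x). -/
theorem contDiffOn_wave_profile (hT : 0 < T) (hρ : 0 < ρ)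
    (hv : ∀ t ∈ Set.Icc 0 T, HasDerivWithinAt v (S.field ρ t (v t)) (Set.Icc 0 T) t) :
    ContDiffOn ℝ ∞ (fun q : ℝ × EuclideanSpace ℝ (Fin d) => wave ρ q (v q.1))
      (Set.Icc 0 T ×ˢ Set.univ) := by
  obtain ⟨η, hη, rfl⟩ : ∃ η : ℝ≥0, 0 < η ∧ ρ = η + η :=
    ⟨ρ / 2, by positivity, by rw [← NNReal.coe_inj]; push_cast; ring⟩
  simp only [← wave_damp]
  have h : ContDiffOn ℝ ∞ (fun t => damp η (v t)) (Set.Icc 0 T) :=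
    contDiffOn_infty.2 fun n => S.contDiffOn_damp_profile hT hv n η η hη rfl
  exact contDiffOn_clm_apply (contDiff_wave hη).contDiffOn
    (h.comp contDiff_fst.contDiffOn fun q hq => hq.1)

end SpectralNonlinearity

/-! ### From profiles to solutions of the differential equation -/

/-- The Laplacian as the sum of the second partial derivatives. -/
theorem laplacian_eq_sum_fderiv_fderiv {Y : Type*} [NormedAddCommGroup Y] [NormedSpace ℝ Y]
    {f : EuclideanSpace ℝ (Fin d) → Y} (hf : ContDiff ℝ 2 f) (x : EuclideanSpace ℝ (Fin d)) :
    Δ f x = ∑ i, fderiv ℝ (fun y => fderiv ℝ f y (EuclideanSpace.single i 1)) x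
      (EuclideanSpace.single i 1) := by
  rw [InnerProductSpace.laplacian_eq_iteratedFDeriv_orthonormalBasis f
    (EuclideanSpace.basisFun (Fin d) ℝ)]
  refine Finset.sum_congr rfl fun i _ => ?_
  have hd : DifferentiableAt ℝ (fderiv ℝ f) x :=
    (hf.fderiv_right (m := 1) (by norm_num)).differentiable one_ne_zero x
  rw [iteratedFDeriv_two_apply, fderiv_clm_apply hd (differentiableAt_const _)]
  simp

theorem laplacian_cexp (c : ℂ) (k : Fin d → ℤ) (x : EuclideanSpace ℝ (Fin d)) :
    Δ (fun y => c * Complex.exp (Complex.I * freqForm k y)) x =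
      -(2 * dispersion k : ℝ) * (c * Complex.exp (Complex.I * freqForm k x)) := by
  have hsm : ContDiff ℝ 2 fun y => c * Complex.exp (Complex.I * freqForm k y) :=
    contDiff_const.mul (by simpa using contDiff_cexp_smul (freqForm k) (1 : ℂ))
  have hd : ∀ (c : ℂ) (i : Fin d) (y : EuclideanSpace ℝ (Fin d)),
      fderiv ℝ (fun y => c * Complex.exp (Complex.I * freqForm k y)) y
        (EuclideanSpace.single i 1) =
      (Complex.I * k i * c) * Complex.exp (Complex.I * freqForm k y) := fun c i y => by
    rw [((hasFDerivAt_cexp (freqForm k) y).const_mul c).fderiv]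
    simp [freqForm_single]
    ring
  rw [laplacian_eq_sum_fderiv_fderiv hsm]
  simp only [hd, ← Finset.sum_mul, dispersion]
  rw [← mul_assoc]
  congr 1
  push_cast
  rw [mul_div_cancel₀ _ (two_ne_zero), ← Finset.sum_neg_distrib, Finset.sum_mul]
  refine Finset.sum_congr rfl fun i _ => ?_
  linear_combination (k i : ℂ) ^ 2 * c * Complex.I_sq

/-- Free waves solve the free Schrödinger equation. -/
theorem wave_free_equation {ρ : ℝ≥0} (hρ : 0 < ρ) (t : ℝ) (x : EuclideanSpace ℝ (Fin d))
    (b : Coeffs d) :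
    Complex.I * (fderiv ℝ (wave (d := d) ρ) (t, x) (1, 0)) b +
      (1 / 2 : ℂ) * Δ (fun y => wave ρ (t, y) b) x = 0 := by
  have hw : ContDiff ℝ 2 (wave (d := d) ρ) := contDiff_infty.1 (contDiff_wave hρ) 2
  have hwt : ContDiff ℝ 2 fun y : EuclideanSpace ℝ (Fin d) => wave ρ (t, y) :=
    hw.comp (contDiff_const.prodMk contDiff_id)
  have hev : ∀ c : Coeffs d, Δ (fun y => wave ρ (t, y) c) x =
      (Δ (fun y : EuclideanSpace ℝ (Fin d) => wave ρ (t, y)) x) c := fun c =>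
    hwt.contDiffAt.laplacian_CLM_comp_left
      (l := (ContinuousLinearMap.apply ℂ ℂ c).restrictScalars ℝ)
  have key : Complex.I • fderiv ℝ (wave (d := d) ρ) (t, x) (1, 0) +
      (1 / 2 : ℂ) • Δ (fun y : EuclideanSpace ℝ (Fin d) => wave ρ (t, y)) x = 0 := by
    -- On a single mode the time derivative gives i(−i|k|²/2) and half the Laplacian gives −|k|²/2.
    refine hom_ext fun k => ?_
    have h1 : (fderiv ℝ (wave (d := d) ρ) (t, x) (1, 0)) (delta k) =
        (-Complex.I * dispersion k) * wave ρ (t, x) (delta k) := by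
      have hA := ((ContinuousLinearMap.apply ℂ ℂ (delta k)).restrictScalars ℝ).hasFDerivAt.comp
        (t, x) (hw.differentiable two_ne_zero (t, x)).hasFDerivAt
      have hB := (hasFDerivAt_cexp (phase k) (t, x)).const_mul
        (Real.exp (-(ρ : ℝ) * absSum k) : ℂ)
      have hfun : (((ContinuousLinearMap.apply ℂ ℂ (delta k)).restrictScalars ℝ) ∘
          wave (d := d) ρ) = fun q => (Real.exp (-(ρ : ℝ) * absSum k) : ℂ) *
            Complex.exp (Complex.I * phase k q) := funext fun q => wave_delta ρ q k
      rw [hfun] at hA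
      have h := DFunLike.congr_fun (hA.unique hB) (1, 0)
      simp only [ContinuousLinearMap.comp_apply, ContinuousLinearMap.coe_restrictScalars',
        ContinuousLinearMap.apply_apply] at h
      rw [h, wave_delta]
      simp [phase_apply]
      ring
    have h2 : (Δ (fun y : EuclideanSpace ℝ (Fin d) => wave ρ (t, y)) x) (delta k) =
        -(2 * dispersion k : ℝ) * wave ρ (t, x) (delta k) := by
      rw [← hev]
      have hfun : ∀ y : EuclideanSpace ℝ (Fin d), wave ρ (t, y) (delta k) =
          ((Real.exp (-(ρ : ℝ) * absSum k) : ℂ) *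
            Complex.exp (Complex.I * (-(dispersion k * t) : ℝ))) *
            Complex.exp (Complex.I * freqForm k y) := fun y => by
        rw [wave_delta, phase_apply, mul_assoc, ← Complex.exp_add]
        congr 2
        push_cast
        ring
      simp only [hfun]
      exact laplacian_cexp _ k x
    simp only [_root_.add_apply, _root_.smul_apply, smul_eq_mul, h1, h2, _root_.zero_apply]
    push_cast
    linear_combination (-(dispersion k : ℂ) * wave ρ (t, x) (delta k)) * Complex.I_sq
  have := DFunLike.congr_fun key b
  simpa [hev] using this

namespace SpectralNonlinearity

variable (S : SpectralNonlinearity d σ μ F) {ρ : ℝ≥0} {T : ℝ} {v : ℝ → Coeffs d}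

/-- By the product rule the time derivative splits into a free part, cancelled by the Laplacian, and
the synthesized vector field, which is −iF(ψ) once the two opposite free evolutions cancel. -/
theorem isSmoothSolution_wave_profile (hT : 0 < T) (hρ : 0 < ρ)
    (hv : ∀ t ∈ Set.Icc 0 T, HasDerivWithinAt v (S.field ρ t (v t)) (Set.Icc 0 T) t) :
    IsSmoothSolution F T fun t x => wave ρ (t, x) (v t) where
  periodic t _ := by
    simp only [← synth_freeGroup]
    exact isPeriodic_synth ρ _
  smooth := S.contDiffOn_wave_profile hT hρ hv
  equation t ht x := by
    have hw : HasDerivWithinAt (fun τ => wave ρ (τ, x))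
        (fderiv ℝ (wave (d := d) ρ) (t, x) (1, 0)) (Set.Icc 0 T) t := by
      have h1 := ((contDiff_wave (d := d) hρ).differentiable (by simp) (t, x)).hasFDerivAt
      have h2 : HasDerivAt (fun τ : ℝ => (τ, x)) ((1 : ℝ), (0 : EuclideanSpace ℝ (Fin d))) t :=
        (hasDerivAt_id t).prodMk (hasDerivAt_const t x)
      exact (h1.comp_hasDerivAt t h2).hasDerivWithinAt
    have hw' := (ContinuousLinearMap.restrictScalarsL ℂ (Coeffs d) ℂ ℝ ℝ).hasFDerivAt
      |>.comp_hasDerivWithinAt t hw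
    have hd := hw'.clm_apply (hv t ht)
    have hF : wave ρ (t, x) (S.field ρ t (v t)) =
        -Complex.I * F (fun y => wave ρ (t, y) (v t)) x := by
      rw [field, map_smul, ← synth_freeGroup, freeGroup_neg_freeGroup, S.synth_apply ρ hρ,
        smul_eq_mul]
      simp only [synth_freeGroup]
    have hd' : HasDerivWithinAt (fun τ => wave ρ (τ, x) (v τ))
        ((fderiv ℝ (wave (d := d) ρ) (t, x) (1, 0)) (v t) +
          wave ρ (t, x) (S.field ρ t (v t))) (Set.Icc 0 T) t := hd
    rw [hd'.derivWithin (uniqueDiffOn_Icc hT t ht), hF]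
    linear_combination wave_free_equation hρ t x (v t) -
      F (fun y => wave ρ (t, y) (v t)) x * Complex.I_sq

end SpectralNonlinearity

end PeriodicNLS
end

/-! ### Uniqueness of smooth solutions by the L² energy method -/

noncomputable section

namespace PeriodicNLS

variable {d : ℕ}

/-- Needed to turn almost everywhere equality of continuous functions on the cell into equality at
every point of it, including the boundary. -/
theorem cell_subset_closure_interior : cell d ⊆ closure (interior (cell d)) := by
  have hconv : Convex ℝ (cell d) := by
    intro x hx y hy a b ha hb hab i
    exact convex_Icc (0 : ℝ) (2 * Real.pi) (hx i) (hy i) ha hb hab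
  have hopen : IsOpen {x : EuclideanSpace ℝ (Fin d) | ∀ i, x i ∈ Set.Ioo 0 (2 * Real.pi)} := by
    have : {x : EuclideanSpace ℝ (Fin d) | ∀ i, x i ∈ Set.Ioo 0 (2 * Real.pi)} =
        ⋂ i, (fun x : EuclideanSpace ℝ (Fin d) => x i) ⁻¹' Set.Ioo 0 (2 * Real.pi) := by
      ext x; simp
    rw [this]
    exact isOpen_iInter_of_finite fun i => isOpen_Ioo.preimage (by fun_prop)
  have hne : (interior (cell d)).Nonempty := by
    refine ⟨WithLp.toLp 2 fun _ => Real.pi, interior_maximal (fun x hx i => ?_) hopen fun i => ?_⟩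
    · exact Set.Ioo_subset_Icc_self (hx i)
    · exact ⟨Real.pi_pos, by change Real.pi < 2 * Real.pi; linarith [Real.pi_pos]⟩
  rw [hconv.closure_interior_eq_closure_of_nonempty_interior hne]
  exact subset_closure

/-- A single lattice translation must serve both functions, so that equality on the cell propagates
everywhere. -/
theorem IsPeriodic.exists_mem_cell {f : EuclideanSpace ℝ (Fin d) → ℂ} (hf : IsPeriodic f)
    {g : EuclideanSpace ℝ (Fin d) → ℂ} (hg : IsPeriodic g) (x : EuclideanSpace ℝ (Fin d)) :
    ∃ y ∈ cell d, f x = f y ∧ g x = g y := by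
  have hper : ∀ {f : EuclideanSpace ℝ (Fin d) → ℂ}, IsPeriodic f → ∀ n : Fin d → ℤ,
      Function.Periodic f (∑ i, n i • EuclideanSpace.single i (2 * Real.pi)) := by
    intro f hf n
    refine Finset.sum_induction _ (fun c => Function.Periodic f c)
      (fun _ _ h1 h2 => h1.add_period h2) (fun x => by simp) fun i _ => ?_
    exact Function.Periodic.zsmul (hf i) (n i)
  set n : Fin d → ℤ := fun i => -⌊x i / (2 * Real.pi)⌋
  refine ⟨x + ∑ i, n i • EuclideanSpace.single i (2 * Real.pi), fun i => ?_,
    (hper hf n x).symm, (hper hg n x).symm⟩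
  have hx : (x + ∑ i, n i • EuclideanSpace.single i (2 * Real.pi)) i =
      2 * Real.pi * Int.fract (x i / (2 * Real.pi)) := by
    have h2 : (2 * Real.pi) ≠ 0 := Real.two_pi_pos.ne'
    simp only [PiLp.add_apply, WithLp.ofLp_sum, WithLp.ofLp_smul, Finset.sum_apply, Pi.smul_apply,
      PiLp.ofLp_single, Pi.single_apply, smul_ite, smul_zero, Finset.sum_ite_eq,
      Finset.mem_univ, if_true, Int.fract, n]
    rw [mul_sub, mul_div_cancel₀ _ h2]
    push_cast [zsmul_eq_mul]
    ring
  rw [hx]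
  exact ⟨mul_nonneg Real.two_pi_pos.le (Int.fract_nonneg _),
    mul_le_of_le_one_right Real.two_pi_pos.le (Int.fract_lt_one _).le⟩

theorem IsPeriodic.fderiv {f : EuclideanSpace ℝ (Fin d) → ℂ} (hf : IsPeriodic f)
    (i : Fin d) (x v : EuclideanSpace ℝ (Fin d)) :
    fderiv ℝ f (x + EuclideanSpace.single i (2 * Real.pi)) v = fderiv ℝ f x v := by
  rw [← fderiv_comp_add_right, funext (hf i)]

/-- The Laplacian is symmetric: `∫ ū Δu` is real for periodic `u`. -/
theorem integral_cell_laplacian_mul_conj_im {u : EuclideanSpace ℝ (Fin d) → ℂ}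
    (hu : ContDiff ℝ 2 u) (hper : IsPeriodic u) :
    (∫ x in cell d, Δ u x * (starRingEnd ℂ) (u x)).im = 0 := by
  set e : Fin d → EuclideanSpace ℝ (Fin d) := fun i => EuclideanSpace.single i 1
  have hu1 : ContDiff ℝ 1 u := hu.of_le one_le_two
  have hD : ∀ i, ContDiff ℝ 1 fun x => fderiv ℝ u x (e i) := fun i =>
    (hu.fderiv_right (m := 1) (by norm_num)).clm_apply contDiff_const
  have hconj : ContDiff ℝ 1 fun x => (starRingEnd ℂ) (u x) :=
    Complex.conjCLE.contDiff.comp hu1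
  have hDconj : ∀ i x, fderiv ℝ (fun x => (starRingEnd ℂ) (u x)) x (e i) =
      (starRingEnd ℂ) (fderiv ℝ u x (e i)) := fun i x => by
    have h := (Complex.conjCLE.toContinuousLinearMap.hasFDerivAt (x := u x)).comp x
      (hu1.differentiable one_ne_zero x).hasFDerivAt
    exact DFunLike.congr_fun h.fderiv (e i)
  -- Integration by parts in differential form: the left side integrates to zero and the last term
  -- is real.
  have hprod : ∀ i x, fderiv ℝ (fun x => fderiv ℝ u x (e i) * (starRingEnd ℂ) (u x)) x (e i) =
      fderiv ℝ (fun y => fderiv ℝ u y (e i)) x (e i) * (starRingEnd ℂ) (u x) +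
      ((‖fderiv ℝ u x (e i)‖ ^ 2 : ℝ) : ℂ) := fun i x => by
    rw [fderiv_fun_mul ((hD i).differentiable one_ne_zero x)
      (hconj.differentiable one_ne_zero x)]
    simp only [_root_.add_apply, _root_.smul_apply, smul_eq_mul, hDconj, Complex.mul_conj']
    push_cast
    ring
  have hzero : ∀ i, ∫ x in cell d,
      fderiv ℝ (fun x => fderiv ℝ u x (e i) * (starRingEnd ℂ) (u x)) x (e i) = 0 := fun i =>
    integral_cell_fderiv_eq_zero ((hD i).mul hconj) (fun j x => by
      simp only [hper.fderiv, hper j x]) i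
  have hc1 : ∀ i, Continuous fun x => fderiv ℝ (fun y => fderiv ℝ u y (e i)) x (e i) *
      (starRingEnd ℂ) (u x) := fun i =>
    (((hD i).continuous_fderiv one_ne_zero).clm_apply continuous_const).mul hconj.continuous
  have hc2 : ∀ i, Continuous fun x => ((‖fderiv ℝ u x (e i)‖ ^ 2 : ℝ) : ℂ) := fun i =>
    Complex.continuous_ofReal.comp ((hD i).continuous.norm.pow 2)
  have hterm : ∀ i, (∫ x in cell d, fderiv ℝ (fun y => fderiv ℝ u y (e i)) x (e i) *
      (starRingEnd ℂ) (u x)).im = 0 := fun i => by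
    have h := hzero i
    simp only [hprod] at h
    rw [integral_add (integrableOn_cell (hc1 i)) (integrableOn_cell (hc2 i)),
      integral_complex_ofReal] at h
    have := congrArg Complex.im h
    simpa using this
  simp only [laplacian_eq_sum_fderiv_fderiv hu, Finset.sum_mul]
  rw [integral_finsetSum _ fun i _ => integrableOn_cell (hc1 i), Complex.im_sum]
  exact Finset.sum_eq_zero fun i _ => hterm i

theorem continuous_laplacian {u : EuclideanSpace ℝ (Fin d) → ℂ} (hu : ContDiff ℝ 2 u) :
    Continuous (Δ u) := by
  rw [funext (laplacian_eq_sum_fderiv_fderiv hu)]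
  refine continuous_finsetSum _ fun i _ => ?_
  have hD : ContDiff ℝ 1 fun x => fderiv ℝ u x (EuclideanSpace.single i 1) :=
    (hu.fderiv_right (m := 1) (by norm_num)).clm_apply contDiff_const
  exact (hD.continuous_fderiv one_ne_zero).clm_apply continuous_const

/-- `F` is Lipschitz in `L²` on sets that are bounded in `L^∞`. -/
def IsL2Lipschitz (F : (EuclideanSpace ℝ (Fin d) → ℂ) → EuclideanSpace ℝ (Fin d) → ℂ) : Prop :=
  ∀ M : ℝ, ∃ C : ℝ, ∀ f g : EuclideanSpace ℝ (Fin d) → ℂ, Continuous f → Continuous g →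
    (∀ x ∈ cell d, ‖f x‖ ≤ M) → (∀ x ∈ cell d, ‖g x‖ ≤ M) →
    ∫ x in cell d, ‖f x - g x‖ * ‖F f x - F g x‖ ≤ C * ∫ x in cell d, ‖f x - g x‖ ^ 2

section Uniqueness

variable {F : (EuclideanSpace ℝ (Fin d) → ℂ) → EuclideanSpace ℝ (Fin d) → ℂ} {T : ℝ}
  {χ ψ : ℝ → EuclideanSpace ℝ (Fin d) → ℂ}

/-- The time derivative of a function on the slab `[0, T] × ℝ^d`. -/
def timeDeriv (T : ℝ) (χ : ℝ → EuclideanSpace ℝ (Fin d) → ℂ) (t : ℝ)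
    (x : EuclideanSpace ℝ (Fin d)) : ℂ :=
  fderivWithin ℝ (fun q : ℝ × EuclideanSpace ℝ (Fin d) => χ q.1 q.2)
    (Set.Icc 0 T ×ˢ Set.univ) (t, x) (1, 0)

theorem IsSmoothSolution.contDiff (h : IsSmoothSolution F T χ) {t : ℝ} (ht : t ∈ Set.Icc 0 T) :
    ContDiff ℝ ∞ (χ t) := by
  have := h.smooth.comp (s := Set.univ) (f := fun x : EuclideanSpace ℝ (Fin d) => (t, x))
    (contDiff_const.prodMk contDiff_id).contDiffOn fun x _ => ⟨ht, trivial⟩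
  exact contDiffOn_univ.1 this

theorem IsSmoothSolution.hasDerivWithinAt (h : IsSmoothSolution F T χ) {t : ℝ}
    (ht : t ∈ Set.Icc 0 T) (x : EuclideanSpace ℝ (Fin d)) :
    HasDerivWithinAt (fun τ => χ τ x) (timeDeriv T χ t x) (Set.Icc 0 T) t := by
  have h1 := ((h.smooth.differentiableOn (by simp)) (t, x) ⟨ht, trivial⟩).hasFDerivWithinAt
  have h2 : HasDerivWithinAt (fun τ : ℝ => (τ, x)) ((1 : ℝ), (0 : EuclideanSpace ℝ (Fin d)))
      (Set.Icc 0 T) t := ((hasDerivAt_id t).prodMk (hasDerivAt_const t x)).hasDerivWithinAt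
  exact h1.comp_hasDerivWithinAt (f := fun τ : ℝ => (τ, x)) t h2 fun τ hτ => ⟨hτ, trivial⟩

theorem IsSmoothSolution.continuousOn_timeDeriv (h : IsSmoothSolution F T χ) (hT : 0 < T) :
    ContinuousOn (fun q : ℝ × EuclideanSpace ℝ (Fin d) => timeDeriv T χ q.1 q.2)
      (Set.Icc 0 T ×ˢ Set.univ) :=
  (h.smooth.continuousOn_fderivWithin ((uniqueDiffOn_Icc hT).prod uniqueDiffOn_univ)
    (by simp)).clm_apply continuousOn_const

theorem IsSmoothSolution.timeDeriv_eq (h : IsSmoothSolution F T χ) (hT : 0 < T) {t : ℝ}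
    (ht : t ∈ Set.Icc 0 T) (x : EuclideanSpace ℝ (Fin d)) :
    timeDeriv T χ t x = Complex.I * (1 / 2 * Δ (χ t) x - F (χ t) x) := by
  have := h.equation t ht x
  rw [(h.hasDerivWithinAt ht x).derivWithin (uniqueDiffOn_Icc hT t ht)] at this
  linear_combination (-Complex.I) * this + timeDeriv T χ t x * Complex.I_sq

theorem exists_bound_on_slab {f : ℝ × EuclideanSpace ℝ (Fin d) → ℂ}
    (hf : ContinuousOn f (Set.Icc 0 T ×ˢ Set.univ)) :
    ∃ M, 0 ≤ M ∧ ∀ t ∈ Set.Icc 0 T, ∀ x ∈ cell d, ‖f (t, x)‖ ≤ M := by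
  obtain ⟨M, hM⟩ := (isCompact_Icc.prod (isCompact_cell (d := d))).exists_bound_of_continuousOn
    (hf.mono (Set.prod_mono_right (Set.subset_univ _)) : ContinuousOn f (Set.Icc 0 T ×ˢ cell d))
  exact ⟨max M 0, le_max_right _ _, fun t ht x hx => (hM (t, x) ⟨ht, hx⟩).trans (le_max_left _ _)⟩

/-- Differentiation under the integral sign, dominated by bounds on the compact slab. The endpoints
are excluded since time derivatives there are one-sided. -/
theorem IsSmoothSolution.hasDerivAt_integral_norm_sq_sub (hχ : IsSmoothSolution F T χ)
    (hψ : IsSmoothSolution F T ψ) (hT : 0 < T) {t : ℝ} (ht : t ∈ Set.Ioo 0 T) :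
    HasDerivAt (fun τ => ∫ x in cell d, ‖χ τ x - ψ τ x‖ ^ 2)
      (∫ x in cell d, 2 * ((timeDeriv T χ t x - timeDeriv T ψ t x) *
        (starRingEnd ℂ) (χ t x - ψ t x)).re) t := by
  obtain ⟨M, hM0, hM⟩ := exists_bound_on_slab (hχ.smooth.continuousOn.sub hψ.smooth.continuousOn)
  obtain ⟨K, hK0, hK⟩ := exists_bound_on_slab
    ((hχ.continuousOn_timeDeriv hT).sub (hψ.continuousOn_timeDeriv hT))
  have hIoo : Set.Ioo 0 T ∈ nhds t := Ioo_mem_nhds ht.1 ht.2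
  have hcw : ∀ τ ∈ Set.Icc 0 T, Continuous fun x => χ τ x - ψ τ x := fun τ hτ =>
    (hχ.contDiff hτ).continuous.sub (hψ.contDiff hτ).continuous
  have hcd : Continuous fun x => timeDeriv T χ t x - timeDeriv T ψ t x := by
    have hti := Set.Ioo_subset_Icc_self ht
    have h := ((hχ.continuousOn_timeDeriv hT).sub (hψ.continuousOn_timeDeriv hT)).comp
      (s := Set.univ) (f := fun x : EuclideanSpace ℝ (Fin d) => (t, x))
      (by fun_prop) fun x _ => ⟨hti, trivial⟩
    exact continuousOn_univ.1 h
  refine (hasDerivAt_integral_of_dominated_loc_of_deriv_le (s := Set.Ioo 0 T)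
    (bound := fun _ => 2 * (K * M))
    (F' := fun τ x => 2 * ((timeDeriv T χ τ x - timeDeriv T ψ τ x) *
        (starRingEnd ℂ) (χ τ x - ψ τ x)).re) hIoo ?_ ?_ ?_ ?_ ?_ ?_).2
  · filter_upwards [hIoo] with τ hτ
    exact ((hcw τ (Set.Ioo_subset_Icc_self hτ)).norm.pow 2).aestronglyMeasurable
  · exact integrableOn_cell ((hcw t (Set.Ioo_subset_Icc_self ht)).norm.pow 2)
  · refine Continuous.aestronglyMeasurable (continuous_const.mul (Complex.continuous_re.comp
      (hcd.mul (Complex.continuous_conj.comp (hcw t (Set.Ioo_subset_Icc_self ht))))))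
  · refine (ae_restrict_iff' measurableSet_cell).2 (Filter.Eventually.of_forall fun x hx τ hτ => ?_)
    have hτ' := Set.Ioo_subset_Icc_self hτ
    rw [norm_mul, Real.norm_ofNat, Real.norm_eq_abs]
    refine mul_le_mul_of_nonneg_left ((Complex.abs_re_le_norm _).trans ?_) zero_le_two
    rw [norm_mul, RCLike.norm_conj]
    exact mul_le_mul (hK τ hτ' x hx) (hM τ hτ' x hx) (norm_nonneg _) hK0
  · exact integrableOn_cell continuous_const
  · refine Filter.Eventually.of_forall fun x τ hτ => ?_
    have hτ' := Set.Ioo_subset_Icc_self hτ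
    have h1 := ((hχ.hasDerivWithinAt hτ' x).sub (hψ.hasDerivWithinAt hτ' x)).hasDerivAt
      (Icc_mem_nhds hτ.1 hτ.2)
    exact h1.norm_sq

/-- Smooth solutions are determined by their initial values. -/
theorem IsSmoothSolution.unique (hF : IsL2Lipschitz F) (hT : 0 < T)
    (hχ : IsSmoothSolution F T χ) (hψ : IsSmoothSolution F T ψ) (h0 : χ 0 = ψ 0) :
    ∀ τ ∈ Set.Icc 0 T, χ τ = ψ τ := by
  obtain ⟨M₁, hM₁0, hM₁⟩ := exists_bound_on_slab hχ.smooth.continuousOn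
  obtain ⟨M₂, hM₂0, hM₂⟩ := exists_bound_on_slab hψ.smooth.continuousOn
  obtain ⟨C, hC⟩ := hF (max M₁ M₂)
  set E : ℝ → ℝ := fun τ => ∫ x in cell d, ‖χ τ x - ψ τ x‖ ^ 2 with hE
  have hE0 : ∀ τ, 0 ≤ E τ := fun τ => integral_nonneg fun x => by positivity
  have hcw : ∀ τ ∈ Set.Icc 0 T, Continuous fun x => χ τ x - ψ τ x := fun τ hτ =>
    (hχ.contDiff hτ).continuous.sub (hψ.contDiff hτ).continuous
  have hEc : ContinuousOn E (Set.Icc 0 T) := by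
    refine continuousOn_of_dominated (bound := fun _ => (M₁ + M₂) ^ 2) (fun τ hτ =>
      ((hcw τ hτ).norm.pow 2).aestronglyMeasurable) (fun τ hτ => ?_)
      (integrableOn_cell continuous_const) (Filter.Eventually.of_forall fun x => ?_)
    · refine (ae_restrict_iff' measurableSet_cell).2 (Filter.Eventually.of_forall fun x hx => ?_)
      rw [Real.norm_of_nonneg (by positivity)]
      exact pow_le_pow_left₀ (norm_nonneg _)
        ((norm_sub_le _ _).trans (add_le_add (hM₁ τ hτ x hx) (hM₂ τ hτ x hx))) 2
    · exact fun τ hτ => (((hχ.hasDerivWithinAt hτ x).continuousWithinAt.sub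
        (hψ.hasDerivWithinAt hτ x).continuousWithinAt).norm.pow 2)
  have hE' : ∀ t ∈ Set.Ioo 0 T, ∃ D, HasDerivAt E D t ∧ D ≤ 2 * C * E t := by
    intro t ht
    have hti := Set.Ioo_subset_Icc_self ht
    refine ⟨_, hχ.hasDerivAt_integral_norm_sq_sub hψ hT ht, ?_⟩
    have hu : ContDiff ℝ 2 (χ t - ψ t) :=
      (contDiff_infty.1 (hχ.contDiff hti) 2).sub (contDiff_infty.1 (hψ.contDiff hti) 2)
    have hper : IsPeriodic (χ t - ψ t) := fun i x => by
      simp only [Pi.sub_apply]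
      rw [hχ.periodic t hti i x, hψ.periodic t hti i x]
    have hlap : ∀ x, Δ (χ t - ψ t) x = Δ (χ t) x - Δ (ψ t) x := fun x =>
      (contDiff_infty.1 (hχ.contDiff hti) 2).contDiffAt.laplacian_sub
        (contDiff_infty.1 (hψ.contDiff hti) 2).contDiffAt
    -- Nothing is assumed about the continuity of F(χ t); it is read off from the equation.
    have hcG : ∀ {χ : ℝ → EuclideanSpace ℝ (Fin d) → ℂ}, IsSmoothSolution F T χ →
        Continuous (F (χ t)) := by
      intro χ hχ
      have h1 : Continuous fun x => timeDeriv T χ t x :=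
        continuousOn_univ.1 ((hχ.continuousOn_timeDeriv hT).comp (s := Set.univ)
          (f := fun x : EuclideanSpace ℝ (Fin d) => (t, x)) (by fun_prop)
          fun x _ => ⟨hti, trivial⟩)
      have h2 := continuous_laplacian (contDiff_infty.1 (hχ.contDiff hti) 2)
      have h3 : F (χ t) = fun x => 1 / 2 * Δ (χ t) x + Complex.I * timeDeriv T χ t x := by
        funext x
        rw [hχ.timeDeriv_eq hT hti x]
        linear_combination (1 / 2 * Δ (χ t) x - F (χ t) x) * (-Complex.I_sq)
      rw [h3]
      exact (continuous_const.mul h2).add (continuous_const.mul h1)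
    have hcL := (continuous_laplacian hu).mul (Complex.continuous_conj.comp (hcw t hti))
    have hcN : Continuous fun x => (F (χ t) x - F (ψ t) x) *
        (starRingEnd ℂ) (χ t x - ψ t x) :=
      ((hcG hχ).sub (hcG hψ)).mul (Complex.continuous_conj.comp (hcw t hti))
    -- The energy identity: the Laplacian term will integrate to zero by symmetry, leaving only the
    -- nonlinearity.
    have hpt : ∀ x, 2 * ((timeDeriv T χ t x - timeDeriv T ψ t x) *
        (starRingEnd ℂ) (χ t x - ψ t x)).re =
        -(Δ (χ t - ψ t) x * (starRingEnd ℂ) (χ t x - ψ t x)).im +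
        2 * ((F (χ t) x - F (ψ t) x) * (starRingEnd ℂ) (χ t x - ψ t x)).im := by
      intro x
      rw [hχ.timeDeriv_eq hT hti x, hψ.timeDeriv_eq hT hti x, hlap]
      have e : (Complex.I * (1 / 2 * Δ (χ t) x - F (χ t) x) -
          Complex.I * (1 / 2 * Δ (ψ t) x - F (ψ t) x)) * (starRingEnd ℂ) (χ t x - ψ t x) =
          Complex.I * (((1 / 2 : ℝ) : ℂ) * ((Δ (χ t) x - Δ (ψ t) x) *
            (starRingEnd ℂ) (χ t x - ψ t x)) -
          (F (χ t) x - F (ψ t) x) * (starRingEnd ℂ) (χ t x - ψ t x)) := by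
        push_cast; ring
      rw [e, Complex.I_mul_re, Complex.sub_im, Complex.im_ofReal_mul]
      ring
    simp only [hpt]
    have hi1 : Integrable (fun x => (Δ (χ t - ψ t) x * (starRingEnd ℂ) (χ t x - ψ t x)).im)
        (volume.restrict (cell d)) := integrableOn_cell (Complex.continuous_im.comp hcL)
    have hi2 : Integrable (fun x => 2 * ((F (χ t) x - F (ψ t) x) *
        (starRingEnd ℂ) (χ t x - ψ t x)).im) (volume.restrict (cell d)) :=
      integrableOn_cell (continuous_const.mul (Complex.continuous_im.comp hcN))
    have hi1' : Integrable (fun x => -(Δ (χ t - ψ t) x * (starRingEnd ℂ) (χ t x - ψ t x)).im)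
        (volume.restrict (cell d)) := hi1.neg
    rw [integral_add hi1' hi2, integral_neg]
    have him : ∫ x in cell d, (Δ (χ t - ψ t) x * (starRingEnd ℂ) (χ t x - ψ t x)).im = 0 :=
      (integral_im (integrableOn_cell hcL)).trans (integral_cell_laplacian_mul_conj_im hu hper)
    rw [him, neg_zero, zero_add]
    have hi3 : Integrable (fun x => 2 * (‖χ t x - ψ t x‖ * ‖F (χ t) x - F (ψ t) x‖))
        (volume.restrict (cell d)) := integrableOn_cell
      (continuous_const.mul ((hcw t hti).norm.mul ((hcG hχ).sub (hcG hψ)).norm))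
    refine (integral_mono hi2 hi3 fun x => ?_).trans ?_
    · refine mul_le_mul_of_nonneg_left ((le_abs_self _).trans ((Complex.abs_im_le_norm _).trans ?_))
        zero_le_two
      rw [norm_mul, RCLike.norm_conj, mul_comm]
    · rw [integral_const_mul, mul_assoc]
      exact mul_le_mul_of_nonneg_left (hC _ _ (hχ.contDiff hti).continuous
        (hψ.contDiff hti).continuous (fun x hx => (hM₁ t hti x hx).trans (le_max_left _ _))
        fun x hx => (hM₂ t hti x hx).trans (le_max_right _ _)) zero_le_two
  -- Grönwall with an integrating factor, which needs no sign of C.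
  have hanti : AntitoneOn (fun t => Real.exp (-(2 * C) * t) * E t) (Set.Icc 0 T) := by
    have hder : ∀ t ∈ Set.Ioo 0 T, ∃ D, HasDerivAt (fun t => Real.exp (-(2 * C) * t) * E t) D t ∧
        D ≤ 0 := by
      intro t ht
      obtain ⟨D, hD, hle⟩ := hE' t ht
      have h1 : HasDerivAt (fun t => Real.exp (-(2 * C) * t))
          (Real.exp (-(2 * C) * t) * (-(2 * C))) t := by
        simpa using ((hasDerivAt_id t).const_mul (-(2 * C))).exp
      refine ⟨_, h1.mul hD, ?_⟩
      nlinarith [Real.exp_pos (-(2 * C) * t)]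
    refine antitoneOn_of_deriv_nonpos (convex_Icc 0 T)
      ((by fun_prop : Continuous fun t : ℝ => Real.exp (-(2 * C) * t)).continuousOn.mul hEc)
      (fun t ht => ?_) fun t ht => ?_
    · rw [interior_Icc] at ht
      obtain ⟨D, hD, _⟩ := hder t ht
      exact hD.differentiableAt.differentiableWithinAt
    · rw [interior_Icc] at ht
      obtain ⟨D, hD, hle⟩ := hder t ht
      rwa [hD.deriv]
  intro τ hτ
  have hEτ : E τ = 0 := by
    have h := hanti (Set.left_mem_Icc.2 hT.le) hτ hτ.1
    have hz : E 0 = 0 := by simp [hE, h0]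
    simp only [hz, mul_zero] at h
    exact le_antisymm (nonpos_of_mul_nonpos_right h (Real.exp_pos _)) (hE0 τ)
  have hae : (fun x => χ τ x) =ᵐ[volume.restrict (cell d)] fun x => ψ τ x := by
    have h := (integral_eq_zero_iff_of_nonneg (fun x => sq_nonneg _)
      (integrableOn_cell ((hcw τ hτ).norm.pow 2))).1 hEτ
    filter_upwards [h] with x hx
    have : ‖χ τ x - ψ τ x‖ ^ 2 = 0 := hx
    exact sub_eq_zero.1 (norm_eq_zero.1 (pow_eq_zero_iff two_ne_zero |>.1 this))
  have heq := Measure.eqOn_of_ae_eq hae (hχ.contDiff hτ).continuous.continuousOn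
    (hψ.contDiff hτ).continuous.continuousOn cell_subset_closure_interior
  funext x
  obtain ⟨y, hy, h1, h2⟩ := (hχ.periodic τ hτ).exists_mem_cell (hψ.periodic τ hτ) x
  rw [h1, h2]
  exact heq hy

end Uniqueness

end PeriodicNLS
end

/-! ### L² Lipschitz bounds for the two nonlinearities -/

noncomputable section

namespace PeriodicNLS

variable {d : ℕ}

theorem norm_powerMap_sub_le (m : ℕ) {z w : ℂ} {M : ℝ} (hz : ‖z‖ ≤ M) (hw : ‖w‖ ≤ M) :
    ‖((‖z‖ ^ (2 * m) : ℝ) : ℂ) * z - ((‖w‖ ^ (2 * m) : ℝ) : ℂ) * w‖ ≤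
      (2 * m + 1) * M ^ (2 * m) * ‖z - w‖ := by
  have hM : 0 ≤ M := (norm_nonneg z).trans hz
  have e : ((‖z‖ ^ (2 * m) : ℝ) : ℂ) * z - ((‖w‖ ^ (2 * m) : ℝ) : ℂ) * w =
      ((‖z‖ ^ (2 * m) : ℝ) : ℂ) * (z - w) + ((‖z‖ ^ (2 * m) - ‖w‖ ^ (2 * m) : ℝ) : ℂ) * w := by
    push_cast; ring
  rw [e]
  refine (norm_add_le _ _).trans ?_
  rw [norm_mul, norm_mul, Complex.norm_real, Complex.norm_real, Real.norm_eq_abs,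
    Real.norm_eq_abs, abs_of_nonneg (by positivity : (0 : ℝ) ≤ ‖z‖ ^ (2 * m))]
  have h1 : ‖z‖ ^ (2 * m) * ‖z - w‖ ≤ M ^ (2 * m) * ‖z - w‖ := by gcongr
  have h2 : |‖z‖ ^ (2 * m) - ‖w‖ ^ (2 * m)| * ‖w‖ ≤ 2 * m * M ^ (2 * m) * ‖z - w‖ := by
    rcases m with _ | m
    · simp
    have h3 := abs_pow_sub_pow_le ‖z‖ ‖w‖ (2 * (m + 1))
    calc _ ≤ (‖z - w‖ * (2 * (m + 1) : ℕ) * M ^ (2 * (m + 1) - 1)) * M := by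
          refine mul_le_mul (h3.trans ?_) hw (norm_nonneg _) (by positivity)
          gcongr
          · exact abs_norm_sub_norm_le z w
          · simpa using ⟨hz, hw⟩
      _ = _ := by
          rw [show 2 * (m + 1) - 1 = 2 * m + 1 by omega]
          push_cast; ring
  linarith

theorem isL2Lipschitz_powerNonlinearity (σ : ℕ) {μ : ℝ} (hμ : |μ| ≤ 1) :
    IsL2Lipschitz (powerNonlinearity d μ σ) := by
  intro M
  refine ⟨(2 * σ + 1) * M ^ (2 * σ), fun f g hf hg hfM hgM => ?_⟩
  rw [← integral_const_mul]
  refine setIntegral_mono_on (integrableOn_cell ?_) (integrableOn_cell ?_) measurableSet_cell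
    fun x hx => ?_
  · unfold powerNonlinearity; fun_prop
  · fun_prop
  · have h := norm_powerMap_sub_le σ (hfM x hx) (hgM x hx)
    have e : powerNonlinearity d μ σ f x - powerNonlinearity d μ σ g x =
        (μ : ℂ) * (((‖f x‖ ^ (2 * σ) : ℝ) : ℂ) * f x - ((‖g x‖ ^ (2 * σ) : ℝ) : ℂ) * g x) := by
      simp only [powerNonlinearity]; ring
    rw [e, norm_mul, Complex.norm_real, Real.norm_eq_abs]
    have h2 := (mul_le_of_le_one_left (norm_nonneg _) hμ).trans h
    calc _ ≤ ‖f x - g x‖ * ((2 * σ + 1) * M ^ (2 * σ) * ‖f x - g x‖) :=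
          mul_le_mul_of_nonneg_left h2 (norm_nonneg _)
      _ = _ := by ring

theorem setIntegral_cell_const (c : ℝ) : ∫ _ in cell d, c = (2 * Real.pi) ^ d * c := by
  simp [measureReal_def, volume_cell, ENNReal.toReal_ofReal, pow_nonneg Real.two_pi_pos.le]

/-- Cauchy–Schwarz against the constant 1, from integrating (Vh − J)² ≥ 0 with V the volume and J
the integral of h. -/
theorem sq_integral_cell_le {h : EuclideanSpace ℝ (Fin d) → ℝ} (hh : Continuous h) :
    (∫ x in cell d, h x) ^ 2 ≤ (2 * Real.pi) ^ d * ∫ x in cell d, h x ^ 2 := by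
  have hV : 0 < (2 * Real.pi) ^ d := pow_pos Real.two_pi_pos d
  set V := (2 * Real.pi) ^ d
  set J := ∫ x in cell d, h x with hJ
  have h0 : 0 ≤ ∫ x in cell d, (V * h x - J) ^ 2 := integral_nonneg fun x => sq_nonneg _
  have e : ∀ x, (V * h x - J) ^ 2 = V ^ 2 * h x ^ 2 - 2 * V * J * h x + J ^ 2 := fun x => by ring
  simp only [e] at h0
  have i1 : IntegrableOn (fun x => V ^ 2 * h x ^ 2) (cell d) := integrableOn_cell (by fun_prop)
  have i2 : IntegrableOn (fun x => 2 * V * J * h x) (cell d) := integrableOn_cell (by fun_prop)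
  have i3 : IntegrableOn (fun x : EuclideanSpace ℝ (Fin d) => J ^ 2) (cell d) :=
    integrableOn_cell continuous_const
  have i12 : IntegrableOn (fun x => V ^ 2 * h x ^ 2 - 2 * V * J * h x) (cell d) := i1.sub i2
  rw [integral_add i12 i3, integral_sub i1 i2, integral_const_mul, integral_const_mul,
    setIntegral_cell_const, ← hJ] at h0
  have h1 : 0 ≤ V * (V * ∫ x in cell d, h x ^ 2) - V * J ^ 2 := by
    have : V ^ 2 * (∫ x in cell d, h x ^ 2) - 2 * V * J * J + V * J ^ 2 =
      V * (V * ∫ x in cell d, h x ^ 2) - V * J ^ 2 := by ring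
    linarith
  exact le_of_mul_le_mul_left (by linarith) hV

theorem isL2Lipschitz_renormalizedNonlinearity {μ : ℝ} (hμ : |μ| ≤ 1) :
    IsL2Lipschitz (renormalizedNonlinearity d μ) := by
  intro M
  -- 9 = 5 + 4: the pointwise terms give 3 + 2, and the nonlocal difference of masses gives 4 after
  -- Cauchy–Schwarz.
  refine ⟨9 * M ^ 2, fun f g hf hg hfM hgM => ?_⟩
  have hV : 0 < (2 * Real.pi) ^ d := pow_pos Real.two_pi_pos d
  set V := (2 * Real.pi) ^ d with hVdef
  set J := ∫ x in cell d, ‖f x - g x‖ with hJ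
  have hJ0 : 0 ≤ J := integral_nonneg fun x => norm_nonneg _
  set mf := ∫ y in cell d, ‖f y‖ ^ 2 with hmf
  set mg := ∫ y in cell d, ‖g y‖ ^ 2 with hmg
  have i1 : IntegrableOn (fun x => ‖f x‖ ^ 2) (cell d) := integrableOn_cell (by fun_prop)
  have i2 : IntegrableOn (fun x => ‖g x‖ ^ 2) (cell d) := integrableOn_cell (by fun_prop)
  have hmf0 : 0 ≤ mf := integral_nonneg fun x => by positivity
  have hmfV : mf ≤ V * M ^ 2 := by
    rw [hVdef, ← setIntegral_cell_const]
    exact setIntegral_mono_on i1 (integrableOn_cell continuous_const) measurableSet_cell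
      fun x hx => pow_le_pow_left₀ (norm_nonneg _) (hfM x hx) 2
  have hdiff : |mf - mg| ≤ 2 * M * J := by
    rw [hmf, hmg, ← integral_sub i1 i2, ← Real.norm_eq_abs, hJ, ← integral_const_mul]
    refine (norm_integral_le_integral_norm _).trans (setIntegral_mono_on
      (integrableOn_cell (by fun_prop)) (integrableOn_cell (by fun_prop)) measurableSet_cell
      fun x hx => ?_)
    rw [Real.norm_eq_abs, sq_sub_sq, abs_mul, abs_of_nonneg (by positivity)]
    have := hfM x hx
    have := hgM x hx
    exact mul_le_mul (by linarith) (abs_norm_sub_norm_le _ _) (abs_nonneg _)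
      (by linarith [norm_nonneg (f x)])
  have hpt : ∀ x ∈ cell d, ‖f x - g x‖ *
      ‖renormalizedNonlinearity d μ f x - renormalizedNonlinearity d μ g x‖ ≤
      5 * M ^ 2 * ‖f x - g x‖ ^ 2 + 4 * M ^ 2 / V * J * ‖f x - g x‖ := by
    intro x hx
    have hM : 0 ≤ M := (norm_nonneg _).trans (hfM x hx)
    have h := norm_powerMap_sub_le 1 (hfM x hx) (hgM x hx)
    have e : renormalizedNonlinearity d μ f x - renormalizedNonlinearity d μ g x =
        (μ : ℂ) * ((((‖f x‖ ^ (2 * 1) : ℝ) : ℂ) * f x - ((‖g x‖ ^ (2 * 1) : ℝ) : ℂ) * g x) -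
          (((2 / V * mf : ℝ) : ℂ) * (f x - g x) + ((2 / V * (mf - mg) : ℝ) : ℂ) * g x)) := by
      simp only [renormalizedNonlinearity, ← hmf, ← hmg, ← hVdef]
      push_cast
      ring
    have h1 : ‖((2 / V * mf : ℝ) : ℂ) * (f x - g x)‖ ≤ 2 * M ^ 2 * ‖f x - g x‖ := by
      rw [norm_mul, Complex.norm_real, Real.norm_of_nonneg (by positivity)]
      refine mul_le_mul_of_nonneg_right ?_ (norm_nonneg _)
      rw [div_mul_eq_mul_div, div_le_iff₀ hV]
      nlinarith
    have h2 : ‖((2 / V * (mf - mg) : ℝ) : ℂ) * g x‖ ≤ 4 * M ^ 2 / V * J := by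
      rw [norm_mul, Complex.norm_real, Real.norm_eq_abs, abs_mul, abs_of_pos (by positivity)]
      calc _ ≤ 2 / V * (2 * M * J) * M := by
            gcongr
            exact hgM x hx
        _ = _ := by ring
    have h3 : ‖renormalizedNonlinearity d μ f x - renormalizedNonlinearity d μ g x‖ ≤
        5 * M ^ 2 * ‖f x - g x‖ + 4 * M ^ 2 / V * J := by
      rw [e, norm_mul, Complex.norm_real, Real.norm_eq_abs]
      refine (mul_le_of_le_one_left (norm_nonneg _) hμ).trans ((norm_sub_le _ _).trans ?_)
      have h4 := norm_add_le (((2 / V * mf : ℝ) : ℂ) * (f x - g x))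
        (((2 / V * (mf - mg) : ℝ) : ℂ) * g x)
      norm_num at h
      norm_num at *
      linarith
    calc _ ≤ ‖f x - g x‖ * (5 * M ^ 2 * ‖f x - g x‖ + 4 * M ^ 2 / V * J) :=
          mul_le_mul_of_nonneg_left h3 (norm_nonneg _)
      _ = _ := by ring
  have hCS := sq_integral_cell_le (h := fun x => ‖f x - g x‖) (by fun_prop)
  rw [← hJ, ← hVdef] at hCS
  have j1 : IntegrableOn (fun x => 5 * M ^ 2 * ‖f x - g x‖ ^ 2) (cell d) :=
    integrableOn_cell (by fun_prop)
  have j2 : IntegrableOn (fun x => 4 * M ^ 2 / V * J * ‖f x - g x‖) (cell d) :=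
    integrableOn_cell (by fun_prop)
  refine (setIntegral_mono_on (integrableOn_cell ?_) (j1.add j2) measurableSet_cell hpt).trans ?_
  · unfold renormalizedNonlinearity; fun_prop
  · rw [integral_add' j1 j2, integral_const_mul, integral_const_mul, ← hJ]
    have h5 : 4 * M ^ 2 / V * J * J ≤ 4 * M ^ 2 * ∫ x in cell d, ‖f x - g x‖ ^ 2 := by
      rw [mul_assoc, ← sq, div_mul_eq_mul_div, div_le_iff₀ hV]
      nlinarith [mul_le_mul_of_nonneg_left hCS (by positivity : 0 ≤ 4 * M ^ 2)]
    linarith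

end PeriodicNLS
end

/-! ### Wave packets and the expansion of the nonlinearity -/

noncomputable section

namespace PeriodicNLS

open SummableFamily

variable {d : ℕ}

/-- The weighted coefficients of the plane wave `e^{ik·x}`. -/
def planeWave (ρ : ℝ≥0) (k : Fin d → ℤ) : Coeffs d := (Real.exp (ρ * absSum k) : ℂ) • delta k

theorem norm_planeWave (ρ : ℝ≥0) (k : Fin d → ℤ) :
    ‖planeWave ρ k‖ = Real.exp (ρ * absSum k) := by
  rw [planeWave, norm_smul, norm_delta, mul_one, Complex.norm_real,
    Real.norm_of_nonneg (Real.exp_pos _).le]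

theorem conv_planeWave (ρ : ℝ≥0) (j k : Fin d → ℤ) :
    conv ρ (planeWave ρ j) (planeWave ρ k) = planeWave ρ (j + k) := by
  simp only [planeWave, map_smul, _root_.smul_apply, conv_delta_delta, smul_smul,
    ← Complex.ofReal_mul, ← Real.exp_add]
  congr 3
  ring

theorem conjRefl_planeWave (ρ : ℝ≥0) (k : Fin d → ℤ) :
    conjRefl (planeWave ρ k) = planeWave ρ (-k) := by
  rw [planeWave, conjRefl_smul, conjRefl_delta, Complex.conj_ofReal, planeWave, absSum_neg]

theorem freeGroup_planeWave (ρ : ℝ≥0) (t : ℝ) (k : Fin d → ℤ) :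
    freeGroup t (planeWave ρ k) =
      Complex.exp (Complex.I * (-(dispersion k) * t : ℝ)) • planeWave ρ k := by
  rw [planeWave, map_smul, freeGroup_delta, smul_comm]

theorem synth_planeWave (ρ : ℝ≥0) (x : EuclideanSpace ℝ (Fin d)) (k : Fin d → ℤ) :
    synth ρ x (planeWave ρ k) = Complex.exp (Complex.I * freqForm k x) := by
  rw [planeWave, map_smul, synth_delta, smul_eq_mul, ← mul_assoc, ← Complex.ofReal_mul,
    ← Real.exp_add]
  simp

theorem coord_planeWave (ρ : ℝ≥0) (j k : Fin d → ℤ) :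
    coord k (planeWave ρ j) = if k = j then (Real.exp (ρ * absSum k) : ℂ) else 0 := by
  rw [planeWave, map_smul, coord_apply, delta_apply]
  split_ifs with h
  · simp [h]
  · simp

/-- Multi-indices for the `2 m + 1` factors of `|u|^{2 m} u`. -/
def FactorIndex (ι : Type) : ℕ → Type
  | 0 => ι
  | m + 1 => ι × ι × FactorIndex ι m

instance FactorIndex.fintype (ι : Type) [Fintype ι] : ∀ m, Fintype (FactorIndex ι m)
  | 0 => inferInstanceAs (Fintype ι)
  | m + 1 =>
    letI := FactorIndex.fintype ι m
    inferInstanceAs (Fintype (ι × ι × FactorIndex ι m))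

theorem FactorIndex.sum_succ {ι : Type} [Fintype ι] {M : Type*} [AddCommMonoid M] {m : ℕ}
    (f : FactorIndex ι (m + 1) → M) :
    ∑ p, f p = ∑ p : FactorIndex ι m, ∑ j, ∑ i, f (show ι × ι × FactorIndex ι m from (i, j, p)) := by
  let g : ι × ι × FactorIndex ι m → M := f
  change ∑ p, g p = ∑ p : FactorIndex ι m, ∑ j, ∑ i, g (i, j, p)
  rw [Fintype.sum_prod_type, Finset.sum_congr rfl fun i _ => Fintype.sum_prod_type _,
    Finset.sum_comm, Finset.sum_congr rfl fun j _ => Finset.sum_comm, Finset.sum_comm]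

/-- The squared length of a frequency. -/
def sqLength (k : Fin d → ℤ) : ℤ := ∑ i, k i ^ 2

/-- The alternating sum `k₁ - k₂ + k₃ - ⋯` of the frequencies of the factors. -/
def totalFreq {ι : Type} (κ : ι → Fin d → ℤ) : ∀ m, FactorIndex ι m → Fin d → ℤ
  | 0, i => κ i
  | m + 1, p => κ p.1 - κ p.2.1 + totalFreq κ m p.2.2

/-- The alternating sum `|k₁|² - |k₂|² + |k₃|² - ⋯`. -/
def totalEnergy {ι : Type} (κ : ι → Fin d → ℤ) : ∀ m, FactorIndex ι m → ℤ
  | 0, i => sqLength (κ i)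
  | m + 1, p => sqLength (κ p.1) - sqLength (κ p.2.1) + totalEnergy κ m p.2.2

/-- The oscillation `e^{-i N² E t / 2}`. -/
def osc (N : ℕ) (E : ℤ) (t : ℝ) : ℂ := Complex.exp (Complex.I * (-(N ^ 2 * E / 2) * t : ℝ))

theorem osc_add (N : ℕ) (E E' : ℤ) (t : ℝ) : osc N (E + E') t = osc N E t * osc N E' t := by
  rw [osc, osc, osc, ← Complex.exp_add]
  congr 1
  push_cast
  ring

theorem conj_osc (N : ℕ) (E : ℤ) (t : ℝ) : (starRingEnd ℂ) (osc N E t) = osc N (-E) t := by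
  rw [osc, osc, ← Complex.exp_conj, map_mul, Complex.conj_I, Complex.conj_ofReal]
  congr 1
  push_cast
  ring

theorem continuous_osc (N : ℕ) (E : ℤ) : Continuous (osc N E) := by
  unfold osc; fun_prop

theorem dispersion_nsmul (N : ℕ) (k : Fin d → ℤ) : dispersion (N • k) = N ^ 2 * sqLength k / 2 := by
  simp only [dispersion, sqLength, Pi.smul_apply, nsmul_eq_mul]
  push_cast
  rw [Finset.mul_sum]
  simp only [mul_pow]

variable {ι : Type} [Fintype ι] (κ : ι → Fin d → ℤ)

/-- The superposition of the plane waves with frequencies `N κ i`, at time `t`. -/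
def packet (ρ : ℝ≥0) (A : ℝ) (N : ℕ) (t : ℝ) : Coeffs d :=
  (A : ℂ) • ∑ i, osc N (sqLength (κ i)) t • planeWave ρ (N • κ i)

theorem freeGroup_packet (ρ : ℝ≥0) (A : ℝ) (N : ℕ) (t : ℝ) :
    freeGroup t (packet κ ρ A N 0) = packet κ ρ A N t := by
  simp only [packet, map_smul, map_sum, freeGroup_planeWave, dispersion_nsmul]
  simp [osc]

/-- Multilinear expansion. Conjugated factors enter with opposite frequency and opposite phase,
hence the alternating sums. -/
theorem powConv_packet (ρ : ℝ≥0) (A : ℝ) (N : ℕ) (t : ℝ) (m : ℕ) :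
    powConv ρ m (packet κ ρ A N t) = ((A : ℂ) ^ (2 * m + 1)) •
      ∑ p : FactorIndex ι m, osc N (totalEnergy κ m p) t • planeWave ρ (N • totalFreq κ m p) := by
  induction m with
  | zero => simp only [powConv, mul_zero, zero_add, pow_one]; rfl
  | succ m ih =>
    have hJ : conjRefl (packet κ ρ A N t) =
        (A : ℂ) • ∑ i, osc N (-sqLength (κ i)) t • planeWave ρ (N • -κ i) := by
      have hsum : ∀ f : ι → Coeffs d, conjRefl (∑ i, f i) = ∑ i, conjRefl (f i) := fun f =>
        map_sum (conjReflL (d := d)) f Finset.univ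
      simp only [packet, conjRefl_smul, hsum, Complex.conj_ofReal, conj_osc, conjRefl_planeWave,
        smul_neg]
    rw [powConv, hJ, ih, packet]
    rw [FactorIndex.sum_succ]
    simp only [map_smul, map_sum, _root_.smul_apply, _root_.sum_apply, conv_planeWave,
      smul_smul, Finset.smul_sum, ← smul_add]
    refine Finset.sum_congr rfl fun p _ => Finset.sum_congr rfl fun j _ =>
      Finset.sum_congr rfl fun i _ => ?_
    simp only [totalEnergy, totalFreq, sub_eq_add_neg, add_assoc, osc_add]
    congr 1
    ring

end PeriodicNLS
end

/-! ### Growth of the zero mode and the size of the data -/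

noncomputable section

namespace PeriodicNLS

open SummableFamily

variable {d σ : ℕ} {μ : ℝ}
  {F : (EuclideanSpace ℝ (Fin d) → ℂ) → EuclideanSpace ℝ (Fin d) → ℂ}
  {ι : Type} [Fintype ι] (κ : ι → Fin d → ℤ)

open Classical in
/-- The sum of the oscillations of the interactions that feed the zero mode. -/
def zeroModeSource (m N : ℕ) (t : ℝ) : ℂ :=
  ∑ p : FactorIndex ι m, if totalFreq κ m p = 0 then osc N (totalEnergy κ m p) t else 0

theorem continuous_zeroModeSource (m N : ℕ) : Continuous (zeroModeSource κ m N) := by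
  unfold zeroModeSource
  refine continuous_finsetSum _ fun p _ => ?_
  split_ifs
  · exact continuous_osc _ _
  · exact continuous_const

theorem nsmul_freq_eq_zero {N : ℕ} (hN : 1 ≤ N) (k : Fin d → ℤ) : (0 = N • k) ↔ k = 0 := by
  rw [eq_comm, smul_eq_zero]
  simp [Nat.one_le_iff_ne_zero.1 hN]

theorem powConv_packet_zero (ρ : ℝ≥0) (A : ℝ) {N : ℕ} (hN : 1 ≤ N) (t : ℝ) (m : ℕ) :
    powConv ρ m (packet κ ρ A N t) 0 = (A : ℂ) ^ (2 * m + 1) * zeroModeSource κ m N t := by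
  rw [← coord_apply, powConv_packet, map_smul, map_sum, smul_eq_mul, zeroModeSource]
  congr 1
  refine Finset.sum_congr rfl fun p _ => ?_
  rw [map_smul, coord_planeWave]
  simp only [nsmul_freq_eq_zero hN]
  split_ifs <;> simp

theorem packet_zero (hκ : ∀ i, κ i ≠ 0) (ρ : ℝ≥0) (A : ℝ) {N : ℕ} (hN : 1 ≤ N) (t : ℝ) :
    packet κ ρ A N t 0 = 0 := by
  rw [← coord_apply, packet, map_smul, map_sum]
  rw [Finset.sum_eq_zero fun i _ => ?_, smul_zero]
  rw [map_smul, coord_planeWave, if_neg ((nsmul_freq_eq_zero hN _).not.2 (hκ i)), smul_zero]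

/-- The condition ρN ≤ 1 keeps the weights e^{ρN|κ_i|} bounded, so the existence time does not
depend on N. -/
theorem norm_packet_le (ρ : ℝ≥0) {A : ℝ} (hA : 0 ≤ A) {N : ℕ} (hρ : (ρ : ℝ) * N ≤ 1) :
    ‖packet κ ρ A N 0‖ ≤ A * ∑ i, Real.exp (absSum (κ i)) := by
  rw [packet, norm_smul, Complex.norm_real, Real.norm_of_nonneg hA]
  refine mul_le_mul_of_nonneg_left ((norm_sum_le _ _).trans (Finset.sum_le_sum fun i _ => ?_)) hA
  rw [norm_smul, norm_planeWave, osc, norm_cexp_I_mul, one_mul, Real.exp_le_exp]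
  have : absSum (N • κ i) = N * absSum (κ i) := by
    simp [absSum, abs_mul, Finset.mul_sum]
  rw [this, ← mul_assoc]
  exact mul_le_of_le_one_left (absSum_nonneg _) hρ

/-- The initial data: equal multiples of plane waves with frequencies `N κ i`. -/
def packetData (A : ℝ) (N : ℕ) (x : EuclideanSpace ℝ (Fin d)) : ℂ :=
  ∑ i, (A : ℂ) * Complex.exp (Complex.I * freqForm (N • κ i) x)

theorem synth_packet (ρ : ℝ≥0) (A : ℝ) (N : ℕ) (x : EuclideanSpace ℝ (Fin d)) :
    synth ρ x (packet κ ρ A N 0) = packetData κ A N x := by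
  simp [packet, packetData, map_sum, synth_planeWave, osc, Finset.mul_sum]

namespace SpectralNonlinearity

variable (S : SpectralNonlinearity d σ μ F)

theorem field_packet_zero (hκ : ∀ i, κ i ≠ 0) (ρ : ℝ≥0) (A : ℝ) {N : ℕ} (hN : 1 ≤ N) (t : ℝ) :
    S.field ρ t (packet κ ρ A N 0) 0 =
      -Complex.I * (μ * ((A : ℂ) ^ (2 * σ + 1) * zeroModeSource κ σ N t)) := by
  rw [← coord_apply, field, map_smul, coord_apply, freeGroup_apply_coord, freeGroup_packet,
    S.zero_mode ρ _ (packet_zero κ hκ ρ A hN t), powConv_packet_zero κ ρ A hN]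
  simp

/-- The zero mode is given, up to a quadratic error, by the first Picard iterate. -/
theorem norm_profile_zero_ge (hμ : |μ| = 1) (hκ : ∀ i, κ i ≠ 0) {ρ : ℝ≥0} {A R T : ℝ} {N : ℕ}
    (hA : 0 ≤ A) (hN : 1 ≤ N) (hT : 0 ≤ T) {v : ℝ → Coeffs d} (hv0 : v 0 = packet κ ρ A N 0)
    (hvR : ∀ t ∈ Set.Icc 0 T, ‖v t‖ ≤ R)
    (hv : ∀ t ∈ Set.Icc 0 T, HasDerivWithinAt v (S.field ρ t (v t)) (Set.Icc 0 T) t) :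
    A ^ (2 * σ + 1) * ‖∫ t in (0 : ℝ)..T, zeroModeSource κ σ N t‖ -
      (S.const * R ^ (2 * σ)) ^ 2 * R * T ^ 2 ≤ ‖v T 0‖ := by
  have hR : 0 ≤ R := (norm_nonneg _).trans (hvR 0 ⟨le_rfl, hT⟩)
  set K := S.const * R ^ (2 * σ) with hK
  have hK0 : 0 ≤ K := mul_nonneg S.const_pos.le (pow_nonneg hR _)
  -- The profile moves by at most KRt. The Lipschitz constant K then bounds the derivative error by
  -- K·KRT, and a second integration gives K²RT².
  have hmove : ∀ t ∈ Set.Icc 0 T, ‖v t - v 0‖ ≤ K * R * (t - 0) :=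
    norm_image_sub_le_of_norm_deriv_le_segment' hv fun t ht =>
      S.norm_field_le ρ t (hvR t (Set.Ico_subset_Icc_self ht))
  set c : ℂ := -Complex.I * (μ * (A : ℂ) ^ (2 * σ + 1)) with hc
  have hW : ∀ t, HasDerivAt (fun t => ∫ s in (0 : ℝ)..t, zeroModeSource κ σ N s)
      (zeroModeSource κ σ N t) t := fun t =>
    ((continuous_zeroModeSource κ σ N).integral_hasStrictDerivAt 0 t).hasDerivAt
  have hder : ∀ t ∈ Set.Icc 0 T, HasDerivWithinAt
      (fun t => v t 0 - c * ∫ s in (0 : ℝ)..t, zeroModeSource κ σ N s)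
      ((S.field ρ t (v t) - S.field ρ t (v 0)) 0) (Set.Icc 0 T) t := by
    intro t ht
    have h1 := ((coord (0 : Fin d → ℤ)).restrictScalars ℝ).hasFDerivAt.comp_hasDerivWithinAt t
      (hv t ht)
    have h2 := ((hW t).const_mul c).hasDerivWithinAt (s := Set.Icc 0 T)
    refine (h1.sub h2).congr_deriv ?_
    rw [← coord_apply, map_sub, coord_apply 0 (S.field ρ t (v 0)), hv0,
      S.field_packet_zero κ hκ ρ A hN]
    simp only [ContinuousLinearMap.coe_restrictScalars', hc]
    ring
  have hmain := norm_image_sub_le_of_norm_deriv_le_segment' (C := K * (K * R * T)) hder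
    (fun t ht => ?_) T ⟨hT, le_rfl⟩
  · simp only [intervalIntegral.integral_same, mul_zero, sub_zero, hv0,
      packet_zero κ hκ ρ A hN] at hmain
    have hcn : ‖c‖ = A ^ (2 * σ + 1) := by
      rw [hc, norm_mul, norm_neg, Complex.norm_I, one_mul, norm_mul, Complex.norm_real,
        Real.norm_eq_abs, hμ, one_mul, norm_pow, Complex.norm_real, Real.norm_of_nonneg hA]
    have h3 := norm_sub_norm_le (c * ∫ s in (0 : ℝ)..T, zeroModeSource κ σ N s) (v T 0)
    rw [norm_mul, hcn, norm_sub_rev] at h3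
    nlinarith
  · have ht' := Set.Ico_subset_Icc_self ht
    refine (norm_apply_le _ _).trans ((S.norm_field_sub_le ρ t (hvR t ht')
      (hvR 0 ⟨le_rfl, hT⟩)).trans ?_)
    refine mul_le_mul_of_nonneg_left ((hmove t ht').trans ?_) hK0
    rw [sub_zero]
    exact mul_le_mul_of_nonneg_left ht'.2 (mul_nonneg hK0 hR)

/-- Existence on a time interval of length `c A^{-2σ}`, with a lower bound on the zero mode. -/
theorem exists_solution_packet (S : SpectralNonlinearity d σ μ F) (hμ : |μ| = 1) (hκ : ∀ i, κ i ≠ 0) :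
    ∃ c C : ℝ, 0 < c ∧ 0 < C ∧ ∀ (A : ℝ) (N : ℕ) (T : ℝ), 0 < A → 1 ≤ N → 0 < T →
      T * A ^ (2 * σ) ≤ c → ∃ ψ : ℝ → EuclideanSpace ℝ (Fin d) → ℂ,
        IsSmoothSolution F T ψ ∧ ψ 0 = packetData κ A N ∧
        A ^ (2 * σ + 1) * ‖∫ t in (0 : ℝ)..T, zeroModeSource κ σ N t‖ -
          C * A * (T * A ^ (2 * σ)) ^ 2 ≤ ‖fourierCoeff (ψ T) 0‖ := by
  -- The summand 1 ensures positivity even without any frequency.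
  set B : ℝ := 1 + ∑ i, Real.exp (absSum (κ i)) with hB
  have hB0 : 0 < B := add_pos_of_pos_of_nonneg one_pos
    (Finset.sum_nonneg fun _ _ => (Real.exp_pos _).le)
  set L := S.const * (2 * B) ^ (2 * σ) with hL
  have hL0 : 0 < L := mul_pos S.const_pos (by positivity)
  -- With radius AB the Lipschitz constant is L A^{2σ}, so 1/(2L) is the smallness condition of the
  -- existence result. The error K²RT² with R = 2AB gives the second constant.
  refine ⟨1 / (2 * L), L ^ 2 * (2 * B), by positivity, by positivity, ?_⟩
  intro A N T hA hN hT hsmall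
  have hN0 : (0 : ℝ) < N := by exact_mod_cast hN
  set ρ : ℝ≥0 := ⟨1 / N, by positivity⟩ with hρdef
  have hρ : 0 < ρ := by
    rw [← NNReal.coe_pos]
    exact one_div_pos.2 hN0
  have hKL : S.const * (2 * (A * B)) ^ (2 * σ) = L * A ^ (2 * σ) := by
    rw [hL, show 2 * (A * B) = 2 * B * A by ring, mul_pow (2 * B) A, mul_assoc]
  have hφ : ‖packet κ ρ A N 0‖ ≤ A * B := by
    refine (norm_packet_le κ ρ hA.le ?_).trans (mul_le_mul_of_nonneg_left (by linarith) hA.le)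
    exact (one_div_mul_cancel hN0.ne').le
  rw [le_div_iff₀ (by positivity)] at hsmall
  obtain ⟨v, hv0, hvR, hv⟩ := S.exists_profile ρ hφ hT.le (by rw [hKL]; linarith)
  refine ⟨fun t x => wave ρ (t, x) (v t), S.isSmoothSolution_wave_profile hT hρ hv, ?_, ?_⟩
  · funext x
    change wave ρ (0, x) (v 0) = _
    rw [hv0, ← synth_packet κ ρ]
    rfl
  · have h := S.norm_profile_zero_ge κ hμ hκ hA.le hN hT.le hv0 hvR hv
    rw [hKL] at h
    have hz : fourierCoeff (fun x => wave ρ (T, x) (v T)) 0 = v T 0 := by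
      simp only [← synth_freeGroup]
      rw [fourierCoeff_synth hρ, freeGroup_apply_coord]
      simp
    rw [hz]
    refine le_trans (le_of_eq ?_) h
    ring

end SpectralNonlinearity

theorem fourierCoeff_packetData (A : ℝ) (N : ℕ) (k : Fin d → ℤ) :
    fourierCoeff (packetData κ A N) k = ∑ i, if k = N • κ i then (A : ℂ) else 0 := by
  have h : packetData κ A N = fun x => synth 1 x (packet κ 1 A N 0) :=
    funext fun x => (synth_packet κ 1 A N x).symm
  rw [h, fourierCoeff_synth one_pos, ← coord_apply, packet, map_smul, map_sum]
  simp only [map_smul, coord_planeWave, osc, smul_eq_mul, Finset.mul_sum]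
  refine Finset.sum_congr rfl fun i _ => ?_
  split_ifs
  · rw [mul_left_comm, mul_left_comm (Real.exp _ : ℂ), ← Complex.ofReal_mul, ← Real.exp_add]
    simp
  · simp

theorem le_japaneseBracket_nsmul {N : ℕ} {k : Fin d → ℤ} (hk : k ≠ 0) :
    (N : ℝ) ≤ japaneseBracket (N • k) := by
  obtain ⟨i, hi⟩ : ∃ i, k i ≠ 0 := by
    by_contra! h
    exact hk (funext h)
  refine Real.le_sqrt_of_sq_le ?_
  have h1 : (1 : ℝ) ≤ (k i : ℝ) ^ 2 := by
    have : 0 < k i ^ 2 := by positivity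
    exact_mod_cast this
  have h2 := Finset.single_le_sum (f := fun i => (((N • k) i : ℤ) : ℝ) ^ 2)
    (fun _ _ => sq_nonneg _) (Finset.mem_univ i)
  have h3 : (((N • k) i : ℤ) : ℝ) ^ 2 = N ^ 2 * (k i : ℝ) ^ 2 := by
    simp [mul_pow]
  nlinarith [sq_nonneg (N : ℝ)]

theorem eLpNorm_count_single_le {X : Type*} [MeasurableSpace X] [MeasurableSingletonClass X]
    (p : ℝ≥0∞) (a : X) (c : ℂ) :
    eLpNorm (Set.indicator {a} fun _ => c) p Measure.count ≤ ‖c‖ₑ := by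
  refine (eLpNorm_indicator_const_le c p).trans ?_
  simp

/-- Each wave contributes a single entry, whose ℓ^p norm is bounded independently of p; since s ≤ 0
and ⟨Nκ_i⟩ ≥ N, the entry is at most A N^s. -/
theorem flNorm_packetData_le (hκ : ∀ i, κ i ≠ 0) {s : ℝ} (hs : s ≤ 0) {p : ℝ≥0∞} (hp : 1 ≤ p)
    {A : ℝ} (hA : 0 ≤ A) {N : ℕ} (hN : 1 ≤ N) :
    flNorm s p (packetData κ A N) ≤ ENNReal.ofReal (Fintype.card ι * (A * (N : ℝ) ^ s)) := by
  have hfun : (fun k : Fin d → ℤ => ((japaneseBracket k ^ s : ℝ) : ℂ) *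
      fourierCoeff (packetData κ A N) k) = ∑ i, Set.indicator {N • κ i}
        fun _ => ((japaneseBracket (N • κ i) ^ s * A : ℝ) : ℂ) := by
    funext k
    rw [fourierCoeff_packetData, Finset.mul_sum, Finset.sum_apply]
    refine Finset.sum_congr rfl fun i _ => ?_
    by_cases h : k = N • κ i
    · rw [if_pos h, h, Set.indicator_of_mem (Set.mem_singleton _), Complex.ofReal_mul]
    · rw [if_neg h, mul_zero, Set.indicator_of_notMem fun hk => h (Set.mem_singleton_iff.1 hk)]
  rw [flNorm, hfun]
  refine (eLpNorm_sum_le (fun i _ => ?_) hp).trans ?_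
  · exact (measurable_of_countable _).aestronglyMeasurable
  have hN0 : (0 : ℝ) < N := by exact_mod_cast hN
  calc _ ≤ ∑ _i : ι, ENNReal.ofReal (A * (N : ℝ) ^ s) := by
        refine Finset.sum_le_sum fun i _ => (eLpNorm_count_single_le _ _ _).trans ?_
        have hj := le_japaneseBracket_nsmul (N := N) (hκ i)
        have h1 := Real.rpow_le_rpow_of_nonpos hN0 hj hs
        have h2 : 0 ≤ japaneseBracket (N • κ i) ^ s := Real.rpow_nonneg (hN0.le.trans hj) s
        rw [← ofReal_norm, Complex.norm_real, Real.norm_of_nonneg (mul_nonneg h2 hA)]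
        refine ENNReal.ofReal_le_ofReal ?_
        rw [mul_comm]
        exact mul_le_mul_of_nonneg_left h1 hA
    _ = _ := by
        rw [Finset.sum_const, Finset.card_univ, nsmul_eq_mul,
          ENNReal.ofReal_mul (Nat.cast_nonneg (Fintype.card ι)), ENNReal.ofReal_natCast]

/-- The bracket at frequency 0 is 1, so neither r nor p matters. -/
theorem le_flNorm (r : ℝ) {p : ℝ≥0∞} (hp : 1 ≤ p) (f : EuclideanSpace ℝ (Fin d) → ℂ) :
    ENNReal.ofReal ‖fourierCoeff f 0‖ ≤ flNorm r p f := by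
  set g : (Fin d → ℤ) → ℂ := fun k => ((japaneseBracket k ^ r : ℝ) : ℂ) * fourierCoeff f k with hg
  have h0 : g 0 = fourierCoeff f 0 := by simp [hg, japaneseBracket]
  have hind : Set.indicator {0} g = Set.indicator {0} fun _ => g 0 := by
    funext k
    by_cases h : k = 0 <;> simp [h]
  calc _ = eLpNorm (Set.indicator ({0} : Set (Fin d → ℤ)) fun _ => g 0) p Measure.count := by
        rw [ofReal_norm, h0]
        rcases eq_or_ne p ∞ with rfl | hp'
        · rw [eLpNorm_exponent_top, eLpNormEssSup_indicator_const_eq _ _ (by simp)]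
        · rw [eLpNorm_indicator_const (measurableSet_singleton _) (by positivity) hp']
          simp
    _ = eLpNorm (Set.indicator {0} g) p Measure.count := by rw [hind]
    _ ≤ _ := eLpNorm_indicator_le g

end PeriodicNLS
end

/-! ### Choice of parameters and norm inflation -/

noncomputable section

namespace PeriodicNLS

open Filter Topology

variable {d σ : ℕ} {μ : ℝ}
  {F : (EuclideanSpace ℝ (Fin d) → ℂ) → EuclideanSpace ℝ (Fin d) → ℂ}
  {ι : Type} [Fintype ι] {κ : ι → Fin d → ℤ}

theorem contDiff_packetData (κ : ι → Fin d → ℤ) (A : ℝ) (N : ℕ) :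
    ContDiff ℝ ∞ (packetData κ A N) := by
  have h : packetData κ A N = fun x => synth 1 x (packet κ 1 A N 0) :=
    funext fun x => (synth_packet κ 1 A N x).symm
  rw [h]
  exact contDiff_synth_apply one_pos _

theorem isPeriodic_packetData (κ : ι → Fin d → ℤ) (A : ℝ) (N : ℕ) :
    IsPeriodic (packetData κ A N) := by
  have h : packetData κ A N = fun x => synth 1 x (packet κ 1 A N 0) :=
    funext fun x => (synth_packet κ 1 A N x).symm
  rw [h]
  exact isPeriodic_synth 1 _

/-- Norm inflation follows if amplitudes, frequency scales and times can be chosen such that the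
first Picard iterate dominates at the zero mode. -/
theorem hasNormInflation_of_packets (S : SpectralNonlinearity d σ μ F) (hF : IsL2Lipschitz F)
    (hμ : |μ| = 1) (hκ : ∀ i, κ i ≠ 0) {s : ℝ} (hs : s ≤ 0)
    (H : ∀ c C : ℝ, 0 < c → 0 < C → ∀ n : ℕ, ∃ (A : ℝ) (N : ℕ) (T : ℝ), 0 < A ∧ 1 ≤ N ∧ 0 < T ∧
      T ≤ 1 / (n + 1) ∧ T * A ^ (2 * σ) ≤ c ∧ A * (N : ℝ) ^ s ≤ 1 / (n + 1) ∧
      n ≤ A ^ (2 * σ + 1) * ‖∫ t in (0 : ℝ)..T, zeroModeSource κ σ N t‖ -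
          C * A * (T * A ^ (2 * σ)) ^ 2) :
    HasNormInflation F s := by
  obtain ⟨c, C, hc, hC, hsol⟩ := S.exists_solution_packet κ hμ hκ
  choose A N T hA hN hT hTn hTc hAN hlow using H c C hc hC
  choose ψ hψ hψ0 hψlow using fun n => hsol (A n) (N n) (T n) (hA n) (hN n) (hT n) (hTc n)
  refine ⟨fun n => packetData κ (A n) (N n), T, ψ,
    fun n => ⟨contDiff_packetData κ _ _, isPeriodic_packetData κ _ _⟩, fun p hp => ?_, hT, ?_,
    fun n => ⟨hψ n, hψ0 n⟩, fun n χ hχ hχ0 => ?_, fun r p hp => ?_⟩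
  · have h1 : Tendsto (fun n : ℕ => ENNReal.ofReal (Fintype.card ι * (1 / ((n : ℝ) + 1)))) atTop
        (nhds 0) := by
      have h := (tendsto_one_div_add_atTop_nhds_zero_nat (𝕜 := ℝ)).const_mul
        (Fintype.card ι : ℝ)
      rw [mul_zero] at h
      simpa using ENNReal.tendsto_ofReal h
    refine tendsto_of_tendsto_of_tendsto_of_le_of_le tendsto_const_nhds h1 (fun n => zero_le)
      fun n => (flNorm_packetData_le κ hκ hs hp (hA n).le (hN n)).trans ?_
    exact ENNReal.ofReal_le_ofReal (mul_le_mul_of_nonneg_left (hAN n) (Nat.cast_nonneg _))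
  · exact tendsto_of_tendsto_of_tendsto_of_le_of_le tendsto_const_nhds
      (tendsto_one_div_add_atTop_nhds_zero_nat (𝕜 := ℝ)) (fun n => (hT n).le) hTn
  · exact hχ.unique hF (hT n) (hψ n) (hχ0.trans (hψ0 n).symm)
  · refine tendsto_nhds_top_mono ENNReal.tendsto_nat_nhds_top (Eventually.of_forall fun n => ?_)
    refine le_trans ?_ (le_flNorm r hp _)
    change (n : ℝ≥0∞) ≤ _
    rw [← ENNReal.ofReal_natCast]
    exact ENNReal.ofReal_le_ofReal ((hlow n).trans (hψlow n))

/-- A nonzero integer E has |E| ≥ 1, so the rate of oscillation is at least N²/2, whatever the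
length of the interval. -/
theorem norm_integral_osc_le {N : ℕ} (hN : 1 ≤ N) {E : ℤ} (hE : E ≠ 0) (T : ℝ) :
    ‖∫ t in (0 : ℝ)..T, osc N E t‖ ≤ 4 / N ^ 2 := by
  have hN0 : (0 : ℝ) < N := by exact_mod_cast hN
  set c : ℂ := Complex.I * ((-(N ^ 2 * E / 2) : ℝ) : ℂ) with hc
  have hE1 : (1 : ℝ) ≤ |(E : ℝ)| := by exact_mod_cast Int.one_le_abs hE
  have hcn : ‖c‖ = N ^ 2 * |(E : ℝ)| / 2 := by
    rw [hc, norm_mul, Complex.norm_I, one_mul, Complex.norm_real, Real.norm_eq_abs, abs_neg,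
      abs_div, abs_mul, abs_of_nonneg (by positivity : (0 : ℝ) ≤ N ^ 2), abs_two]
  have hc0 : 0 < ‖c‖ := by rw [hcn]; positivity
  have hosc : ∀ t : ℝ, osc N E t = Complex.exp (c * t) := fun t => by
    rw [osc, hc, Complex.ofReal_mul, mul_assoc]
  have h1 : ∀ t : ℝ, ‖Complex.exp (c * t)‖ = 1 := fun t => by
    rw [← hosc, osc, norm_cexp_I_mul]
  simp only [hosc]
  rw [integral_exp_mul_complex (norm_pos_iff.1 hc0), norm_div, div_le_div_iff₀ hc0 (by positivity)]
  have h2 := norm_sub_le (Complex.exp (c * T)) (Complex.exp (c * (0 : ℝ)))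
  rw [h1, h1] at h2
  rw [hcn]
  have h3 : (N : ℝ) ^ 2 ≤ N ^ 2 * |(E : ℝ)| := le_mul_of_one_le_right (by positivity) hE1
  calc _ ≤ (1 + 1) * (N : ℝ) ^ 2 := by gcongr
    _ ≤ _ := by linarith

theorem tendsto_integral_osc (E : ℤ) (T : ℝ) :
    Tendsto (fun N : ℕ => ∫ t in (0 : ℝ)..T, osc N E t) atTop
      (nhds (if E = 0 then (T : ℂ) else 0)) := by
  split_ifs with hE
  · refine tendsto_const_nhds.congr fun N => ?_
    simp [osc, hE]
  · rw [tendsto_zero_iff_norm_tendsto_zero]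
    have h : Tendsto (fun N : ℕ => 4 / (N : ℝ) ^ 2) atTop (nhds 0) :=
      Tendsto.const_div_atTop ((tendsto_pow_atTop two_ne_zero).comp tendsto_natCast_atTop_atTop) 4
    refine tendsto_of_tendsto_of_tendsto_of_le_of_le' tendsto_const_nhds h
      (Eventually.of_forall fun N => norm_nonneg _) ?_
    filter_upwards [eventually_ge_atTop 1] with N hN
    exact norm_integral_osc_le hN hE T

/-- For large frequency scales only the resonant interactions contribute. -/
theorem eventually_le_norm_integral_zeroModeSource {m : ℕ} {q : FactorIndex ι m}
    (hq : totalFreq κ m q = 0) (hq' : totalEnergy κ m q = 0) {T : ℝ} (hT : 0 < T) :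
    ∀ᶠ N : ℕ in atTop, T / 2 ≤ ‖∫ t in (0 : ℝ)..T, zeroModeSource κ m N t‖ := by
  classical
  have hlim : Tendsto (fun N : ℕ => ∫ t in (0 : ℝ)..T, zeroModeSource κ m N t) atTop
      (nhds (∑ p : FactorIndex ι m, if totalFreq κ m p = 0 then
        (if totalEnergy κ m p = 0 then (T : ℂ) else 0) else 0)) := by
    have hinteg : ∀ N : ℕ, ∫ t in (0 : ℝ)..T, zeroModeSource κ m N t =
        ∑ p : FactorIndex ι m, if totalFreq κ m p = 0 then
          ∫ t in (0 : ℝ)..T, osc N (totalEnergy κ m p) t else 0 := fun N => by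
      simp only [zeroModeSource]
      rw [intervalIntegral.integral_finsetSum fun p _ => ?_]
      · refine Finset.sum_congr rfl fun p _ => ?_
        split_ifs <;> simp
      · split_ifs
        · exact (continuous_osc _ _).intervalIntegrable _ _
        · simp
    simp only [hinteg]
    refine tendsto_finsetSum _ fun p _ => ?_
    split_ifs with h1 h2
    · simpa [h2] using tendsto_integral_osc (totalEnergy κ m p) T
    · simpa [h2] using tendsto_integral_osc (totalEnergy κ m p) T
    · exact tendsto_const_nhds
  set L := ∑ p : FactorIndex ι m, if totalFreq κ m p = 0 then
        (if totalEnergy κ m p = 0 then (T : ℂ) else 0) else 0 with hL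
  -- The limit is T times the number of resonant interactions. All terms have nonnegative real part,
  -- so nothing cancels the one from q.
  have hLT : T ≤ ‖L‖ := by
    refine le_trans ?_ (Complex.re_le_norm L)
    rw [hL, Complex.re_sum]
    have h := Finset.single_le_sum (f := fun p : FactorIndex ι m => (if totalFreq κ m p = 0 then
        (if totalEnergy κ m p = 0 then (T : ℂ) else 0) else 0 : ℂ).re)
      (fun p _ => by split_ifs <;> simp [hT.le]) (Finset.mem_univ q)
    simpa [hq, hq'] using h
  exact (hlim.norm.eventually (lt_mem_nhds (by linarith : T / 2 < ‖L‖))).mono fun N hN => hN.le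

/-- With T A^{2σ} = c the main term is at least cA/2 and the error at most cA/4. Both are free of N,
which alone makes the data small. -/
theorem hasNormInflation_of_resonance (S : SpectralNonlinearity d σ μ F) (hF : IsL2Lipschitz F)
    (hμ : |μ| = 1) (hσ : 1 ≤ σ) (hκ : ∀ i, κ i ≠ 0) {q : FactorIndex ι σ}
    (hq : totalFreq κ σ q = 0) (hq' : totalEnergy κ σ q = 0) {s : ℝ} (hs : s < 0) :
    HasNormInflation F s := by
  refine hasNormInflation_of_packets S hF hμ hκ hs.le fun c₀ C hc₀ hC n => ?_
  set c := min c₀ (1 / (4 * C)) with hc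
  have hc0 : 0 < c := lt_min hc₀ (by positivity)
  have hcC : C * c ≤ 1 / 4 := by
    have := min_le_right c₀ (1 / (4 * C))
    rw [← hc, le_div_iff₀ (by positivity)] at this
    linarith
  -- The three summands ensure A ≥ 1, T ≤ 1/(n + 1) and cA/4 ≥ n.
  set A : ℝ := 1 + c * (n + 1) + 4 * n / c with hA
  have hA1 : 1 ≤ A := by rw [hA]; linarith [(by positivity : 0 ≤ c * ((n : ℝ) + 1) + 4 * n / c)]
  have hA0 : 0 < A := one_pos.trans_le hA1
  have hAc : c * (n + 1) ≤ A := by rw [hA]; linarith [(by positivity : 0 ≤ 4 * (n : ℝ) / c)]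
  have hAn : n ≤ A * c / 4 := by
    have : 4 * n / c ≤ A := by rw [hA]; linarith [(by positivity : 0 ≤ c * ((n : ℝ) + 1))]
    rw [div_le_iff₀ hc0] at this
    linarith
  set T := c / A ^ (2 * σ) with hT
  have hAp : 0 < A ^ (2 * σ) := by positivity
  have hT0 : 0 < T := by positivity
  have hTA : T * A ^ (2 * σ) = c := div_mul_cancel₀ _ hAp.ne'
  have hlim : Tendsto (fun N : ℕ => A * (N : ℝ) ^ s) atTop (nhds 0) := by
    have h := ((tendsto_rpow_neg_atTop (neg_pos.2 hs)).comp
      tendsto_natCast_atTop_atTop).const_mul A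
    simpa using h
  -- N is chosen last, with A and T already fixed.
  have hev := (hlim.eventually_lt_const (by positivity : (0 : ℝ) < 1 / (n + 1))).and
    ((eventually_le_norm_integral_zeroModeSource hq hq' hT0).and (eventually_ge_atTop 1))
  obtain ⟨N, hN1, hN2, hN3⟩ := hev.exists
  refine ⟨A, N, T, hA0, hN3, hT0, ?_, ?_, hN1.le, ?_⟩
  · rw [hT, div_le_div_iff₀ hAp (by positivity), one_mul]
    exact hAc.trans (le_self_pow₀ hA1 (by omega))
  · rw [hTA]; exact min_le_left _ _
  · rw [hTA]
    have h1 : A ^ (2 * σ + 1) * (T / 2) ≤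
        A ^ (2 * σ + 1) * ‖∫ t in (0 : ℝ)..T, zeroModeSource κ σ N t‖ := by gcongr
    have h2 : A ^ (2 * σ + 1) * (T / 2) = A * c / 2 := by
      rw [pow_succ]
      calc _ = T * A ^ (2 * σ) * A / 2 := by ring
        _ = _ := by rw [hTA]; ring
    have h3 : C * A * c ^ 2 ≤ A * c / 4 := by
      calc C * A * c ^ 2 = (C * c) * (A * c) := by ring
        _ ≤ 1 / 4 * (A * c) := by gcongr
        _ = _ := by ring
    linarith

/-- A rectangle of frequencies in two different directions is resonant. -/
theorem hasNormInflation_of_two_le_dim (S : SpectralNonlinearity d 1 μ F) (hF : IsL2Lipschitz F)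
    (hμ : |μ| = 1) (hd : 2 ≤ d) {s : ℝ} (hs : s < 0) : HasNormInflation F s := by
  set i₀ : Fin d := ⟨0, by omega⟩ with hi₀
  set i₁ : Fin d := ⟨1, by omega⟩ with hi₁
  have hne : i₀ ≠ i₁ := by simp [hi₀, hi₁]
  set a : Fin d → ℤ := Pi.single i₀ 1 with ha
  set b : Fin d → ℤ := Pi.single i₁ 1 with hb
  -- Pythagoras for orthogonal a and b is the resonance condition.
  have hab : sqLength (a + b) = sqLength a + sqLength b := by
    simp only [sqLength, ← Finset.sum_add_distrib]
    refine Finset.sum_congr rfl fun i _ => ?_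
    rcases eq_or_ne i i₀ with rfl | h0
    · simp [ha, hb, hne]
    · simp [ha, h0]
  have ha0 : a ≠ 0 := fun h => by simpa [ha] using congrFun h i₀
  have hb0 : b ≠ 0 := fun h => by simpa [hb] using congrFun h i₁
  have hab0 : a + b ≠ 0 := fun h => by simpa [ha, hb, hne] using congrFun h i₀
  refine hasNormInflation_of_resonance (κ := ![a, a + b, b]) S hF hμ le_rfl
    (fun i => by fin_cases i <;> assumption)
    (q := ((0 : Fin 3), (1 : Fin 3), (2 : Fin 3))) ?_ ?_ hs
  · change a - (a + b) + b = 0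
    abel
  · change sqLength a - sqLength (a + b) + sqLength b = 0
    rw [hab]; ring

/-- The frequencies `1, 3, 1, 3, 4` and trivial pairs form a resonance in one direction. -/
theorem hasNormInflation_of_two_le_degree (S : SpectralNonlinearity d σ μ F)
    (hF : IsL2Lipschitz F) (hμ : |μ| = 1) (hd : 1 ≤ d) (hσ : 2 ≤ σ) {s : ℝ} (hs : s < 0) :
    HasNormInflation F s := by
  set i₀ : Fin d := ⟨0, by omega⟩
  set e : ℤ → Fin d → ℤ := fun z => Pi.single i₀ z with he
  have hsq : ∀ z, sqLength (e z) = z ^ 2 := fun z => by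
    rw [sqLength, Finset.sum_eq_single i₀ (fun i _ hi => by simp [he, hi]) (by simp)]
    simp [he]
  have hadd : ∀ y z, e y + e z = e (y + z) := fun y z => (Pi.single_add _ _ _).symm
  have hsub : ∀ y z, e y - e z = e (y - z) := fun y z => (Pi.single_sub _ _ _).symm
  have hne : ∀ z, z ≠ 0 → e z ≠ 0 := fun z hz h => hz (by simpa [he] using congrFun h i₀)
  set κ : Fin 3 → Fin d → ℤ := ![e 1, e 3, e 4]
  have hres : ∀ m, ∃ q : FactorIndex (Fin 3) (m + 2),
      totalFreq κ (m + 2) q = 0 ∧ totalEnergy κ (m + 2) q = 0 := by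
    intro m
    induction m with
    | zero =>
      refine ⟨((0 : Fin 3), (1 : Fin 3), (0 : Fin 3), (1 : Fin 3), (2 : Fin 3)), ?_, ?_⟩
      · change e 1 - e 3 + (e 1 - e 3 + e 4) = 0
        simp only [hadd, hsub]
        simp [he]
      · change sqLength (e 1) - sqLength (e 3) +
          (sqLength (e 1) - sqLength (e 3) + sqLength (e 4)) = 0
        simp only [hsq]
        norm_num
    | succ m ih =>
      obtain ⟨q, hq, hq'⟩ := ih
      refine ⟨((0 : Fin 3), (0 : Fin 3), q), ?_, ?_⟩
      · change κ 0 - κ 0 + totalFreq κ (m + 2) q = 0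
        rw [hq, sub_self, add_zero]
      · change sqLength (κ 0) - sqLength (κ 0) + totalEnergy κ (m + 2) q = 0
        rw [hq', sub_self, add_zero]
  obtain ⟨m, rfl⟩ : ∃ m, σ = m + 2 := ⟨σ - 2, by omega⟩
  obtain ⟨q, hq, hq'⟩ := hres m
  refine hasNormInflation_of_resonance (κ := κ) S hF hμ (by omega) (fun i => ?_) hq hq' hs
  fin_cases i
  · exact hne 1 one_ne_zero
  · exact hne 3 three_ne_zero
  · exact hne 4 four_ne_zero

/-- On the circle the frequencies `1, 2` interact as `1 - 2 + 1 = 0`, without resonance. -/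
theorem zeroModeSource_one_two (N : ℕ) (t : ℝ) :
    zeroModeSource (d := 1) (ι := Fin 2) ![fun _ => 1, fun _ => 2] 1 N t =
      Complex.exp (Complex.I * (N ^ 2 * t : ℝ)) := by
  rw [zeroModeSource, FactorIndex.sum_succ]
  change ∑ p : Fin 2, _ = _
  simp only [Fin.sum_univ_two, totalFreq, totalEnergy, Matrix.cons_val_zero, Matrix.cons_val_one,
    funext_iff, Pi.add_apply, Pi.sub_apply, Pi.zero_apply, sqLength, Finset.univ_unique,
    Finset.sum_singleton, forall_const]
  -- Of the eight index triples only 1 − 2 + 1 vanishes; its energy 1 − 4 + 1 = −2 gives the phase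
  -- N²t.
  norm_num
  rw [osc]
  congr 2
  push_cast
  ring

/-- Up to time N^{-2} the phase turns by one radian only, so the integral keeps a fixed fraction of
its maximal size. -/
theorem norm_integral_zeroModeSource_one_two {N : ℕ} (hN : 1 ≤ N) :
    1 / 2 / (N : ℝ) ^ 2 ≤ ‖∫ t in (0 : ℝ)..(1 / (N : ℝ) ^ 2),
      zeroModeSource (d := 1) (ι := Fin 2) ![fun _ => 1, fun _ => 2] 1 N t‖ := by
  have hN0 : (0 : ℝ) < N := by exact_mod_cast hN
  have hN2 : (N : ℝ) ^ 2 ≠ 0 := by positivity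
  have hI : Complex.I * ((N : ℝ) ^ 2 : ℝ) ≠ 0 :=
    mul_ne_zero Complex.I_ne_zero (by exact_mod_cast hN2)
  have h1 : ∀ t : ℝ, Complex.exp (Complex.I * (N ^ 2 * t : ℝ)) =
      Complex.exp ((Complex.I * ((N : ℝ) ^ 2 : ℝ)) * t) := fun t => by
    rw [Complex.ofReal_mul, mul_assoc]
  simp only [zeroModeSource_one_two, h1]
  rw [integral_exp_mul_complex hI, norm_div, norm_mul, Complex.norm_I, one_mul, Complex.norm_real,
    Real.norm_of_nonneg (by positivity)]
  refine div_le_div_of_nonneg_right ?_ (by positivity)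
  have h2 : Complex.I * ((N : ℝ) ^ 2 : ℝ) * ((1 / (N : ℝ) ^ 2 : ℝ) : ℂ) = (1 : ℝ) * Complex.I := by
    rw [mul_assoc, ← Complex.ofReal_mul, mul_one_div_cancel hN2, mul_comm]
  rw [h2, Complex.ofReal_zero, mul_zero, Complex.exp_zero]
  -- The imaginary part of e^i − 1 is sin 1, which exceeds 1/2.
  refine le_trans ?_ (Complex.abs_im_le_norm _)
  rw [Complex.sub_im, Complex.exp_ofReal_mul_I_im, Complex.one_im, sub_zero]
  refine le_trans ?_ (le_abs_self _)
  have := Real.sin_gt_sub_cube one_pos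
  norm_num at this
  linarith

/-- With A = N^α and T = N^{-2} the main term is of order N^{3α−2}, the smallness parameter is
N^{2α−2} and the data have size N^{α+s}. The constraints 2/3 < α < 1 and α < −s are compatible
precisely for s < −2/3. -/
theorem hasNormInflation_circle {F : (EuclideanSpace ℝ (Fin 1) → ℂ) → EuclideanSpace ℝ (Fin 1) → ℂ}
    (S : SpectralNonlinearity 1 1 μ F) (hF : IsL2Lipschitz F) (hμ : |μ| = 1) {s : ℝ}
    (hs : s < -2 / 3) : HasNormInflation F s := by
  refine hasNormInflation_of_packets (κ := ![fun _ => 1, fun _ => 2]) S hF hμ (fun i => ?_)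
    (by linarith) fun c C hc hC n => ?_
  · fin_cases i <;> exact fun h => by simpa using congrFun h 0
  obtain ⟨α, hα1, hα2⟩ : ∃ α : ℝ, 2 / 3 < α ∧ α < min 1 (-s) :=
    exists_between (lt_min (by norm_num) (by linarith))
  have hα3 : α < 1 := hα2.trans_le (min_le_left _ _)
  have hα4 : α < -s := hα2.trans_le (min_le_right _ _)
  have hneg : ∀ β : ℝ, β < 0 → Tendsto (fun N : ℕ => (N : ℝ) ^ β) atTop (nhds 0) := fun β hβ => by
    have h := (tendsto_rpow_neg_atTop (neg_pos.2 hβ)).comp (tendsto_natCast_atTop_atTop (R := ℝ))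
    simp only [neg_neg] at h
    exact h
  have hpos : Tendsto (fun N : ℕ => (N : ℝ) ^ (3 * α - 2)) atTop atTop :=
    (tendsto_rpow_atTop (by linarith)).comp tendsto_natCast_atTop_atTop
  have ev1 := (hneg (α + s) (by linarith)).eventually_lt_const
    (by positivity : (0 : ℝ) < 1 / (n + 1))
  have ev2 := (hneg (-2) (by norm_num)).eventually_lt_const
    (by positivity : (0 : ℝ) < 1 / (n + 1))
  have ev3 := (hneg (2 * α - 2) (by linarith)).eventually_lt_const
    (lt_min hc (by positivity : (0 : ℝ) < 1 / (4 * C)))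
  have ev4 := hpos.eventually_ge_atTop (4 * n : ℝ)
  obtain ⟨N, h1, h2, h3, h4, hN⟩ :=
    (ev1.and (ev2.and (ev3.and (ev4.and (eventually_ge_atTop 1))))).exists
  have hN0 : (0 : ℝ) < N := by exact_mod_cast hN
  set A : ℝ := (N : ℝ) ^ α with hA
  have hA0 : 0 < A := Real.rpow_pos_of_pos hN0 α
  have hA2 : A ^ 2 = (N : ℝ) ^ (2 * α) := by
    rw [hA, ← Real.rpow_natCast, ← Real.rpow_mul hN0.le]; push_cast; ring_nf
  have hA3 : A ^ 3 = (N : ℝ) ^ (3 * α) := by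
    rw [hA, ← Real.rpow_natCast, ← Real.rpow_mul hN0.le]; push_cast; ring_nf
  have hN2 : (N : ℝ) ^ 2 = (N : ℝ) ^ (2 : ℝ) := by rw [← Real.rpow_natCast]; norm_num
  have hTA : 1 / (N : ℝ) ^ 2 * A ^ (2 * 1) = (N : ℝ) ^ (2 * α - 2) := by
    rw [mul_one, hA2, hN2, Real.rpow_sub hN0, one_div, inv_mul_eq_div]
  refine ⟨A, N, 1 / (N : ℝ) ^ 2, hA0, hN, by positivity, ?_, ?_, ?_, ?_⟩
  · rw [Real.rpow_neg hN0.le, ← hN2, ← one_div] at h2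
    exact h2.le
  · rw [hTA]; exact h3.le.trans (min_le_left _ _)
  · rw [hA, ← Real.rpow_add hN0]; exact h1.le
  · rw [hTA]
    set ε := (N : ℝ) ^ (2 * α - 2) with hε
    have hε0 : 0 < ε := Real.rpow_pos_of_pos hN0 _
    have hεC : C * ε ≤ 1 / 4 := by
      have := h3.le.trans (min_le_right _ _)
      rw [le_div_iff₀ (by positivity)] at this
      linarith
    have hAε : A * ε = (N : ℝ) ^ (3 * α - 2) := by
      rw [hA, hε, ← Real.rpow_add hN0]; ring_nf
    have h5 : A ^ (2 * 1 + 1) * (1 / 2 / (N : ℝ) ^ 2) = A * ε / 2 := by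
      rw [hAε, Real.rpow_sub hN0, ← hA3, ← hN2]; ring
    have h6 := mul_le_mul_of_nonneg_left (norm_integral_zeroModeSource_one_two hN)
      (by positivity : 0 ≤ A ^ (2 * 1 + 1))
    rw [h5] at h6
    have h7 : C * A * ε ^ 2 ≤ A * ε / 4 := by
      calc C * A * ε ^ 2 = (C * ε) * (A * ε) := by ring
        _ ≤ 1 / 4 * (A * ε) := by gcongr
        _ = _ := by ring
    rw [← hAε] at h4
    linarith

end PeriodicNLS
end

theorem theorem1p1 (σ d : ℕ) (hσ : 1 ≤ σ) (hd : 1 ≤ d) (μ : ℝ) (hμ : μ = 1 ∨ μ = -1) :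
    (2 ≤ d * σ → ∀ s : ℝ, s < 0 →
      PeriodicNLS.HasNormInflation (PeriodicNLS.powerNonlinearity d μ σ) s) ∧
    (2 ≤ d → ∀ s : ℝ, s < 0 →
      PeriodicNLS.HasNormInflation (PeriodicNLS.renormalizedNonlinearity d μ) s) ∧
    (d = 1 → σ = 1 → ∀ s : ℝ, s < -2 / 3 →
      PeriodicNLS.HasNormInflation (PeriodicNLS.powerNonlinearity d μ σ) s ∧
      PeriodicNLS.HasNormInflation (PeriodicNLS.renormalizedNonlinearity d μ) s) := by
  have hμ' : |μ| = 1 := by rcases hμ with rfl | rfl <;> simp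
  have hP := PeriodicNLS.isL2Lipschitz_powerNonlinearity (d := d) σ hμ'.le
  have hR := PeriodicNLS.isL2Lipschitz_renormalizedNonlinearity (d := d) hμ'.le
  refine ⟨fun hdσ s hs => ?_, fun hd2 s hs => ?_, ?_⟩
  -- Either σ = 1, which forces d ≥ 2 and the rectangle, or σ ≥ 2 and a resonance in one direction
  -- suffices.
  · rcases Nat.lt_or_ge σ 2 with h | h
    · obtain rfl : σ = 1 := by omega
      exact PeriodicNLS.hasNormInflation_of_two_le_dim
        (PeriodicNLS.spectralPower d 1 hμ'.le) hP hμ' (by omega) hs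
    · exact PeriodicNLS.hasNormInflation_of_two_le_degree
        (PeriodicNLS.spectralPower d σ hμ'.le) hP hμ' hd h hs
  · exact PeriodicNLS.hasNormInflation_of_two_le_dim
      (PeriodicNLS.spectralRenormalized d hμ'.le) hR hμ' hd2 hs
  · rintro rfl rfl s hs
    exact ⟨PeriodicNLS.hasNormInflation_circle (PeriodicNLS.spectralPower 1 1 hμ'.le) hP hμ' hs,
      PeriodicNLS.hasNormInflation_circle (PeriodicNLS.spectralRenormalized 1 hμ'.le) hR hμ' hs⟩
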